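/- Let $K$ be a field, let $a_1,a_2,a_3$ be distinct positive integers, let $A=(a_1\ a_2\ a_3)\in\mathbb Z^{1\times 3}$ and $\ker(A)=\{u\in\mathbb Z^3 : Au=0\}$. For $u\in\mathbb Z^3$ let $u^+,u^-\in\mathbb N^3$ be the positive and negative parts, so that $u=u^+-u^-$. The toric ideal is $I_A=\langle x^{u^+}-x^{u^-} : u\in\ker(A)\rangle\subseteq K[x_1,x_2,x_3]$. A Markov basis is a set $B\subseteq\ker(A)$ with $I_A=\langle x^{u^+}-x^{u^-}:u\in B\rangle$; it is minimal if no proper subset is a Markov basis. $A$ is a complete intersection if $I_A$ can be generated by $\operatorname{rank}\ker(A)=2$ elements. A circuit is an element of $\ker(A)$ supported on exactly two coordinates. A set $B\subseteq\ker(A)$ reduces the distance of $Z\subseteq\ker(A)$ if for every nonzero $z\in Z$ there are $u\in B$ and a sign $\epsilon\in\{1,-1\}$ such that either $z^++\epsilon u\in\mathbb N^3$ and $\|z^++\epsilon u-z^-\|_1<\|z\|_1$, or $z^-+\epsilon u\in\mathbb N^3$ and $\|z^+-(z^-+\epsilon u)\|_1<\|z\|_1$. $B$ is distance reducing if it reduces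 the distance of $\ker(A)$. Theorem. Let $M$ be a minimal Markov basis of $A$. (a) $M$ is distance reducing if and only if $M$ reduces the distance of the circuits of $A$. (b) Suppose that $A$ is a complete intersection. After a suitable permutation of the coordinates, and up to the signs of its elements, $M=\{b,c\}$ with $b=(b_1,-b_2,0)$, $c=(c_1,c_2,-c_3)$, $b_1>b_2>0$, $c_1,c_2\ge 0$, $c_3>0$. For every permutation of the coordinates after which $M$ has this form (where $a_1,a_2,a_3$ now denote the entries of $A$ in the permuted order), the following are equivalent: (1) $M$ is distance reducing; (2) $M$ reduces the distance of the circuit $\gamma(0,a_3,-a_2)$, where $\gamma=1/\gcd(a_2,a_3)$; (3) $c_1<c_2+c_3$. (c) Suppose that $A$ is not a complete intersection and order the coordinates so that $a_1<a_2<a_3$. Then, up to the signs of its elements, $M=\{(-c_1,v_{12},v_{13}),\ (v_{21},-c_2,v_{23}),\ (v_{31},v_{32},-c_3)\}$ with all $c_i$ and $v_{ij}$ positive, and the following are equivalent: (1) $M$ is distance reducing; (2) $M$ reduces the distance of the circuit $\gamma(0,a_3,-a_2)$, where $\gamma=1/\gcd(a_2,a_3)$; (3) $v_{21}<c_2+v_{23}$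 or $v_{31}<v_{32}+c_3$. -/

import Mathlib

/-- The lattice `ker A ⊆ ℤⁿ` of an integer matrix `A`. -/
abbrev latticeKer {d n : ℕ} (A : Matrix (Fin d) (Fin n) ℤ) : Submodule ℤ (Fin n → ℤ) :=
  LinearMap.ker A.mulVecLin

/-- The binomial `x ^ u⁺ - x ^ u⁻` of a vector `u ∈ ℤⁿ`. -/
noncomputable def moveBinomial (K : Type*) [Field K] {n : ℕ} (u : Fin n → ℤ) :
    MvPolynomial (Fin n) K :=
  MvPolynomial.monomial (Finsupp.equivFunOnFinite.symm fun i => (u i).toNat) 1 -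
    MvPolynomial.monomial (Finsupp.equivFunOnFinite.symm fun i => (-u i).toNat) 1

/-- The toric ideal `I_A`, generated by the binomials of all elements of `ker A`. -/
noncomputable def toricIdeal (K : Type*) [Field K] {d n : ℕ} (A : Matrix (Fin d) (Fin n) ℤ) :
    Ideal (MvPolynomial (Fin n) K) :=
  Ideal.span (moveBinomial K '' (latticeKer A : Set (Fin n → ℤ)))

/-- A Markov basis of `A`: a set of elements of `ker A` whose binomials generate `I_A`. -/
def IsMarkovBasis (K : Type*) [Field K] {d n : ℕ} (A : Matrix (Fin d) (Fin n) ℤ)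
    (B : Set (Fin n → ℤ)) : Prop :=
  B ⊆ (latticeKer A : Set (Fin n → ℤ)) ∧ Ideal.span (moveBinomial K '' B) = toricIdeal K A

/-- A minimal Markov basis: a Markov basis no proper subset of which is a Markov basis. -/
def IsMinimalMarkovBasis (K : Type*) [Field K] {d n : ℕ} (A : Matrix (Fin d) (Fin n) ℤ)
    (B : Set (Fin n → ℤ)) : Prop :=
  IsMarkovBasis K A B ∧ ∀ B' : Set (Fin n → ℤ), B' ⊂ B → ¬ IsMarkovBasis K A B'

/-- `A` is a complete intersection: `I_A` is generated by `nullity A` elements. -/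
def IsCompleteIntersection (K : Type*) [Field K] {d n : ℕ} (A : Matrix (Fin d) (Fin n) ℤ) : Prop :=
  ∃ f : Fin (Module.finrank ℤ (latticeKer A)) → MvPolynomial (Fin n) K,
    Ideal.span (Set.range f) = toricIdeal K A

/-- The metric induced by the `1`-norm. -/
def l1dist {n : ℕ} (x y : Fin n → ℤ) : ℤ := ∑ i, |x i - y i|

/-- The move `u` (used in the direction `+u` or `-u`) is applicable to `z⁺` or to `z⁻`, that is,
it leads from that point to a point with non-negative coordinates, and by applying it the
distance between `z⁺` and `z⁻` drops. -/
def MoveReduces {n : ℕ} (u z : Fin n → ℤ) : Prop :=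
  (u⁻ ≤ z⁺ ∧ l1dist (z⁺ + u) z⁻ < l1dist z⁺ z⁻) ∨
  (u⁺ ≤ z⁺ ∧ l1dist (z⁺ - u) z⁻ < l1dist z⁺ z⁻) ∨
  (u⁻ ≤ z⁻ ∧ l1dist z⁺ (z⁻ + u) < l1dist z⁺ z⁻) ∨
  (u⁺ ≤ z⁻ ∧ l1dist z⁺ (z⁻ - u) < l1dist z⁺ z⁻)

/-- `B` reduces the distance of `Z`. The zero vector (the case of two equal points, at distance
zero) is not considered. -/
def ReducesDistance {n : ℕ} (B Z : Set (Fin n → ℤ)) : Prop :=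
  ∀ z ∈ Z, z ≠ 0 → ∃ u ∈ B, MoveReduces u z

/-- `B` is distance reducing for `A`: it reduces the distance of `ker A`. -/
def IsDistanceReducing {d n : ℕ} (A : Matrix (Fin d) (Fin n) ℤ) (B : Set (Fin n → ℤ)) : Prop :=
  ReducesDistance B (latticeKer A : Set (Fin n → ℤ))

/-- The circuits of a one-row matrix: the elements of the kernel that are supported on exactly
two coordinates. -/
def circuits {n : ℕ} (A : Matrix (Fin 1) (Fin n) ℤ) : Set (Fin n → ℤ) :=
  {z | z ∈ latticeKer A ∧ (Function.support z).ncard = 2}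

/-- The vector whose coordinate at the column `ρ s` is `w s`: here `ρ` lists the columns of a
matrix in a new order, and `w` is written with respect to the new order. -/
def relabel (ρ : Equiv.Perm (Fin 3)) (w : Fin 3 → ℤ) : Fin 3 → ℤ := fun t => w (ρ.symm t)

/-- The circuit `γ (0, a₃, -a₂)`, `γ = 1 / gcd (a₂, a₃)`, where `a₁, a₂, a₃` are the entries of
`A` in the order given by `ρ`. -/
def lastCircuit (A : Matrix (Fin 1) (Fin 3) ℤ) (ρ : Equiv.Perm (Fin 3)) : Fin 3 → ℤ :=
  relabel ρ ![0, A 0 (ρ 2) / (Int.gcd (A 0 (ρ 1)) (A 0 (ρ 2)) : ℤ),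
    -(A 0 (ρ 1) / (Int.gcd (A 0 (ρ 1)) (A 0 (ρ 2)) : ℤ))]

/-- In the order of the columns given by `ρ` and up to the signs of its elements, `M` is
`{(b₁, -b₂, 0), (c₁, c₂, -c₃)}` with `b₁ > b₂ > 0`, `c₁, c₂ ≥ 0`, `c₃ > 0`. -/
def HasCIForm (M : Set (Fin 3 → ℤ)) (ρ : Equiv.Perm (Fin 3)) (b₁ b₂ c₁ c₂ c₃ : ℤ) : Prop :=
  0 < b₂ ∧ b₂ < b₁ ∧ 0 ≤ c₁ ∧ 0 ≤ c₂ ∧ 0 < c₃ ∧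
    ∃ ε₁ ε₂ : ℤˣ, M = {ε₁ • relabel ρ ![b₁, -b₂, 0], ε₂ • relabel ρ ![c₁, c₂, -c₃]}

/-- In the order of the columns given by `ρ` and up to the signs of its elements, `M` is
`{(-c₁, v₁₂, v₁₃), (v₂₁, -c₂, v₂₃), (v₃₁, v₃₂, -c₃)}` with all `cᵢ` and `vᵢⱼ` positive. -/
def HasNonCIForm (M : Set (Fin 3 → ℤ)) (ρ : Equiv.Perm (Fin 3))
    (c₁ c₂ c₃ v₁₂ v₁₃ v₂₁ v₂₃ v₃₁ v₃₂ : ℤ) : Prop :=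
  0 < c₁ ∧ 0 < c₂ ∧ 0 < c₃ ∧ 0 < v₁₂ ∧ 0 < v₁₃ ∧ 0 < v₂₁ ∧ 0 < v₂₃ ∧ 0 < v₃₁ ∧ 0 < v₃₂ ∧
    ∃ ε₁ ε₂ ε₃ : ℤˣ, M = {ε₁ • relabel ρ ![-c₁, v₁₂, v₁₃], ε₂ • relabel ρ ![v₂₁, -c₂, v₂₃],
      ε₃ • relabel ρ ![v₃₁, v₃₂, -c₃]}

/-- The positive part of an integer vector, as an exponent vector. -/
noncomputable def natPos {n : ℕ} (u : Fin n → ℤ) : Fin n →₀ ℕ :=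
  Finsupp.equivFunOnFinite.symm fun i => (u i).toNat

@[simp] lemma natPos_apply {n : ℕ} (u : Fin n → ℤ) (i : Fin n) : natPos u i = (u i).toNat := rfl

lemma moveBinomial_eq (K : Type*) [Field K] {n : ℕ} (u : Fin n → ℤ) :
    moveBinomial K u =
      MvPolynomial.monomial (natPos u) 1 - MvPolynomial.monomial (natPos (-u)) 1 := rfl

/-- One application of a move of `B` to a point of `ℕⁿ`. -/
def MoveStep {n : ℕ} (B : Set (Fin n → ℤ)) (x y : Fin n →₀ ℕ) : Prop :=
  ∃ u ∈ B, ∃ r, x = r + natPos u ∧ y = r + natPos (-u)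

/-- Two points are connected if one reaches the other by moves of `B` inside `ℕⁿ`. -/
abbrev MoveConn {n : ℕ} (B : Set (Fin n → ℤ)) : (Fin n →₀ ℕ) → (Fin n →₀ ℕ) → Prop :=
  Relation.EqvGen (MoveStep B)

lemma MoveConn.add_left {n : ℕ} {B : Set (Fin n → ℤ)} {x y : Fin n →₀ ℕ} (h : MoveConn B x y)
    (s : Fin n →₀ ℕ) : MoveConn B (s + x) (s + y) := by
  induction h with
  | rel x y h =>
    obtain ⟨u, hu, r, rfl, rfl⟩ := h
    exact .rel _ _ ⟨u, hu, s + r, (add_assoc _ _ _).symm, (add_assoc _ _ _).symm⟩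
  | refl x => exact .refl _
  | symm x y _ ih => exact .symm _ _ ih
  | trans x y z _ _ ih1 ih2 => exact .trans _ _ _ ih1 ih2

lemma monomial_sub_mem_of_moveConn (K : Type*) [Field K] {n : ℕ} {B : Set (Fin n → ℤ)}
    {x y : Fin n →₀ ℕ} (h : MoveConn B x y) :
    (MvPolynomial.monomial x 1 - MvPolynomial.monomial y 1 : MvPolynomial (Fin n) K) ∈
      Ideal.span (moveBinomial K '' B) := by
  induction h with
  | rel x y h =>
    obtain ⟨u, hu, r, rfl, rfl⟩ := h
    have : (MvPolynomial.monomial (r + natPos u) 1 - MvPolynomial.monomial (r + natPos (-u)) 1 :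
        MvPolynomial (Fin n) K) = MvPolynomial.monomial r 1 * moveBinomial K u := by
      simp [moveBinomial_eq, mul_sub, MvPolynomial.monomial_mul]
    rw [this]
    exact Ideal.mul_mem_left _ _ (Ideal.subset_span ⟨u, hu, rfl⟩)
  | refl x => simp
  | symm x y _ ih => simpa using neg_mem ih
  | trans x y z _ _ ih1 ih2 => simpa using add_mem ih1 ih2

/-- The linear map which adds up the coefficients over each connected component. -/
noncomputable def componentSum (K : Type*) [Field K] {n : ℕ} (B : Set (Fin n → ℤ)) :
    MvPolynomial (Fin n) K →ₗ[K] (Quot (MoveStep B) →₀ K) :=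
  (MvPolynomial.basisMonomials (Fin n) K).constr K fun x => Finsupp.single (Quot.mk _ x) 1

lemma componentSum_monomial (K : Type*) [Field K] {n : ℕ} (B : Set (Fin n → ℤ))
    (x : Fin n →₀ ℕ) :
    componentSum K B (MvPolynomial.monomial x 1) = Finsupp.single (Quot.mk _ x) 1 := by
  have := (MvPolynomial.basisMonomials (Fin n) K).constr_basis K
    (fun x => Finsupp.single (Quot.mk (MoveStep B) x) (1 : K)) x
  simpa [componentSum] using this

lemma componentSum_eq_zero (K : Type*) [Field K] {n : ℕ} {B : Set (Fin n → ℤ)}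
    {f : MvPolynomial (Fin n) K} (hf : f ∈ Ideal.span (moveBinomial K '' B)) :
    componentSum K B f = 0 := by
  suffices h : ∀ p, componentSum K B (p * f) = 0 by simpa using h 1
  induction hf using Submodule.span_induction with
  | mem f hf =>
    obtain ⟨u, hu, rfl⟩ := hf
    intro p
    induction p using MvPolynomial.induction_on' with
    | monomial r a =>
      have : (MvPolynomial.monomial r a : MvPolynomial (Fin n) K) * moveBinomial K u =
          a • (MvPolynomial.monomial (r + natPos u) 1 -
            MvPolynomial.monomial (r + natPos (-u)) 1) := by
        simp [moveBinomial_eq, mul_sub, MvPolynomial.monomial_mul, smul_sub,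
          MvPolynomial.smul_monomial]
      rw [this, map_smul, map_sub, componentSum_monomial, componentSum_monomial,
        Quot.sound (⟨u, hu, r, rfl, rfl⟩ : MoveStep B (r + natPos u) (r + natPos (-u)))]
      simp
    | add p q hp hq => rw [add_mul, map_add, hp, hq, add_zero]
  | zero => simp
  | add f g _ _ hf hg => intro p; rw [mul_add, map_add, hf, hg, add_zero]
  | smul q f _ hf => intro p; rw [smul_eq_mul, ← mul_assoc, hf]

/-- A pure difference of monomials lies in the ideal of a set of moves if and only if the moves
connect its exponents. -/
lemma monomial_sub_mem_iff (K : Type*) [Field K] {n : ℕ} {B : Set (Fin n → ℤ)}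
    {x y : Fin n →₀ ℕ} :
    (MvPolynomial.monomial x 1 - MvPolynomial.monomial y 1 : MvPolynomial (Fin n) K) ∈
      Ideal.span (moveBinomial K '' B) ↔ MoveConn B x y := by
  refine ⟨fun h => ?_, monomial_sub_mem_of_moveConn K⟩
  have := componentSum_eq_zero K h
  rw [map_sub, componentSum_monomial, componentSum_monomial, sub_eq_zero] at this
  exact Quot.eqvGen_exact (Finsupp.single_left_injective one_ne_zero this)

/-- The `A`-degree of a point. -/
def weight {n : ℕ} (A : Matrix (Fin 1) (Fin n) ℤ) (x : Fin n →₀ ℕ) : ℤ := ∑ j, A 0 j * (x j : ℤ)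

lemma weight_add {n : ℕ} (A : Matrix (Fin 1) (Fin n) ℤ) (x y : Fin n →₀ ℕ) :
    weight A (x + y) = weight A x + weight A y := by
  simp [weight, mul_add, Finset.sum_add_distrib]

@[simp] lemma weight_single {n : ℕ} (A : Matrix (Fin 1) (Fin n) ℤ) (i : Fin n) (c : ℕ) :
    weight A (Finsupp.single i c) = A 0 i * c := by
  classical
  simp [weight, Finsupp.single_apply]

lemma weight_nonneg {n : ℕ} {A : Matrix (Fin 1) (Fin n) ℤ} (hpos : ∀ j, 0 < A 0 j)
    (x : Fin n →₀ ℕ) : 0 ≤ weight A x :=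
  Finset.sum_nonneg fun j _ => mul_nonneg (hpos j).le (by positivity)

lemma eq_zero_of_weight {n : ℕ} {A : Matrix (Fin 1) (Fin n) ℤ} (hpos : ∀ j, 0 < A 0 j)
    {x : Fin n →₀ ℕ} (h : weight A x = 0) : x = 0 := by
  ext j
  have := (Finset.sum_eq_zero_iff_of_nonneg
    fun j _ => mul_nonneg (hpos j).le (by positivity : (0 : ℤ) ≤ x j)).1 h j (Finset.mem_univ j)
  simpa [(hpos j).ne'] using this

lemma mem_latticeKer_iff {n : ℕ} {A : Matrix (Fin 1) (Fin n) ℤ} {u : Fin n → ℤ} :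
    u ∈ latticeKer A ↔ ∑ j, A 0 j * u j = 0 := by
  simp [latticeKer, LinearMap.mem_ker, funext_iff, Matrix.mulVec, dotProduct]

lemma toNat_sub_toNat_neg (a : ℤ) : ((a.toNat : ℤ) - ((-a).toNat : ℤ)) = a := by omega

lemma weight_natPos_sub {n : ℕ} (A : Matrix (Fin 1) (Fin n) ℤ) (u : Fin n → ℤ) :
    weight A (natPos u) - weight A (natPos (-u)) = ∑ j, A 0 j * u j := by
  simp only [weight, ← Finset.sum_sub_distrib, ← mul_sub, natPos_apply, Pi.neg_apply,
    toNat_sub_toNat_neg]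

lemma weight_natPos {n : ℕ} {A : Matrix (Fin 1) (Fin n) ℤ} {u : Fin n → ℤ}
    (hu : u ∈ latticeKer A) : weight A (natPos u) = weight A (natPos (-u)) := by
  have := weight_natPos_sub A u
  rw [mem_latticeKer_iff.1 hu] at this
  linarith

lemma MoveConn.weight_eq {n : ℕ} {A : Matrix (Fin 1) (Fin n) ℤ} {B : Set (Fin n → ℤ)}
    (hB : B ⊆ (latticeKer A : Set (Fin n → ℤ))) {x y : Fin n →₀ ℕ} (h : MoveConn B x y) :
    weight A x = weight A y := by
  induction h with
  | rel x y h =>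
    obtain ⟨u, hu, r, rfl, rfl⟩ := h
    rw [weight_add, weight_add, weight_natPos (hB hu)]
  | refl x => rfl
  | symm x y _ ih => exact ih.symm
  | trans x y z _ _ ih1 ih2 => exact ih1.trans ih2

/-- The difference of two points. -/
def pointDiff {n : ℕ} (x y : Fin n →₀ ℕ) : Fin n → ℤ := fun i => (x i : ℤ) - y i

lemma pointDiff_mem {n : ℕ} {A : Matrix (Fin 1) (Fin n) ℤ} {x y : Fin n →₀ ℕ} :
    pointDiff x y ∈ latticeKer A ↔ weight A x = weight A y := by
  rw [mem_latticeKer_iff, ← sub_eq_zero (a := weight A x)]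
  simp [pointDiff, weight, mul_sub]

lemma moveConn_latticeKer {n : ℕ} {A : Matrix (Fin 1) (Fin n) ℤ} {x y : Fin n →₀ ℕ}
    (h : weight A x = weight A y) : MoveConn (latticeKer A : Set (Fin n → ℤ)) x y := by
  refine .rel _ _ ⟨pointDiff x y, pointDiff_mem.2 h, x ⊓ y, ?_, ?_⟩ <;> ext i <;>
    simp [pointDiff] <;> omega

lemma IsMarkovBasis.moveConn {K : Type*} [Field K] {n : ℕ} {A : Matrix (Fin 1) (Fin n) ℤ}
    {B : Set (Fin n → ℤ)} (hB : IsMarkovBasis K A B) {x y : Fin n →₀ ℕ}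
    (h : weight A x = weight A y) : MoveConn B x y := by
  rw [← monomial_sub_mem_iff K, hB.2, toricIdeal, monomial_sub_mem_iff K]
  exact moveConn_latticeKer h

lemma IsMinimalMarkovBasis.not_moveConn {K : Type*} [Field K] {n : ℕ}
    {A : Matrix (Fin 1) (Fin n) ℤ} {M : Set (Fin n → ℤ)} (hM : IsMinimalMarkovBasis K A M)
    {u : Fin n → ℤ} (hu : u ∈ M) : ¬ MoveConn (M \ {u}) (natPos u) (natPos (-u)) := by
  intro h
  refine hM.2 (M \ {u}) ⟨Set.sdiff_subset, fun h' => (h' hu).2 rfl⟩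
    ⟨Set.sdiff_subset.trans hM.1.1, ?_⟩
  rw [← hM.1.2]
  refine le_antisymm (Ideal.span_mono (Set.image_mono Set.sdiff_subset)) (Ideal.span_le.2 ?_)
  rintro _ ⟨v, hv, rfl⟩
  by_cases hvu : v = u
  · subst hvu
    exact (monomial_sub_mem_iff K).2 h
  · exact Ideal.subset_span ⟨v, ⟨hv, hvu⟩, rfl⟩

lemma MoveConn.of_weight_lt {n : ℕ} {A : Matrix (Fin 1) (Fin n) ℤ} (hpos : ∀ j, 0 < A 0 j)
    {B : Set (Fin n → ℤ)} (hB : B ⊆ (latticeKer A : Set (Fin n → ℤ))) {u : Fin n → ℤ}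
    {x y : Fin n →₀ ℕ} (h : MoveConn B x y) (hx : weight A x < weight A (natPos u)) :
    MoveConn (B \ {u}) x y := by
  induction h with
  | rel x y h =>
    obtain ⟨v, hv, r, rfl, rfl⟩ := h
    refine .rel _ _ ⟨v, ⟨hv, ?_⟩, r, rfl, rfl⟩
    rintro rfl
    rw [weight_add] at hx
    linarith [weight_nonneg hpos r]
  | refl x => exact .refl _
  | symm x y h ih => exact .symm _ _ (ih (MoveConn.weight_eq hB h ▸ hx))
  | trans x y z h h' ih1 ih2 => exact .trans _ _ _ (ih1 hx) (ih2 (MoveConn.weight_eq hB h ▸ hx))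

/-- Two points of the fibre of `u` with a common support element are connected without `u`. -/
lemma IsMarkovBasis.moveConn_diff {K : Type*} [Field K] {n : ℕ} {A : Matrix (Fin 1) (Fin n) ℤ}
    (hpos : ∀ j, 0 < A 0 j) {B : Set (Fin n → ℤ)} (hB : IsMarkovBasis K A B) {u : Fin n → ℤ}
    {x y : Fin n →₀ ℕ} (hx : weight A x = weight A (natPos u)) (hxy : weight A x = weight A y)
    {i : Fin n} (hxi : x i ≠ 0) (hyi : y i ≠ 0) : MoveConn (B \ {u}) x y := by
  classical
  have key : ∀ z : Fin n →₀ ℕ, z i ≠ 0 → Finsupp.single i 1 + (z - Finsupp.single i 1) = z := by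
    intro z hz
    exact add_tsub_cancel_of_le (Finsupp.single_le_iff.2 (Nat.one_le_iff_ne_zero.2 hz))
  rw [← key x hxi, ← key y hyi]
  rw [← key x hxi, weight_add, weight_single] at hx
  rw [← key x hxi, ← key y hyi, weight_add, weight_add] at hxy
  have := hpos i
  refine MoveConn.add_left (MoveConn.of_weight_lt hpos hB.1 (hB.moveConn (by linarith)) ?_) _
  push_cast at hx
  linarith

lemma MoveConn.exists_le {n : ℕ} {B : Set (Fin n → ℤ)} {x y : Fin n →₀ ℕ}
    (h : MoveConn B x y) : x = y ∨
      (∃ u ∈ B, natPos u ≤ x ∨ natPos (-u) ≤ x) ∧ ∃ u ∈ B, natPos u ≤ y ∨ natPos (-u) ≤ y := by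
  induction h with
  | rel x y h =>
    obtain ⟨u, hu, r, rfl, rfl⟩ := h
    exact .inr ⟨⟨u, hu, .inl le_add_self⟩, u, hu, .inr le_add_self⟩
  | refl x => exact .inl rfl
  | symm x y _ ih => exact ih.imp Eq.symm And.symm
  | trans x y z _ _ ih1 ih2 =>
    rcases ih1 with rfl | ih1
    · exact ih2
    · rcases ih2 with rfl | ih2
      · exact .inr ih1
      · exact .inr ⟨ih1.1, ih2.2⟩

lemma pointDiff_natPos {n : ℕ} (u : Fin n → ℤ) : pointDiff (natPos u) (natPos (-u)) = u :=
  funext fun i => toNat_sub_toNat_neg (u i)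

lemma MoveConn.pointDiff_mem_span {n : ℕ} {B : Set (Fin n → ℤ)} {x y : Fin n →₀ ℕ}
    (h : MoveConn B x y) : pointDiff x y ∈ Submodule.span ℤ B := by
  induction h with
  | rel x y h =>
    obtain ⟨u, hu, r, rfl, rfl⟩ := h
    have : pointDiff (r + natPos u) (r + natPos (-u)) = u := by
      rw [← pointDiff_natPos u]
      ext i
      simp [pointDiff]
    rw [this]
    exact Submodule.subset_span hu
  | refl x =>
    have : pointDiff x x = 0 := by ext i; simp [pointDiff]
    rw [this]
    exact zero_mem _
  | symm x y _ ih =>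
    have : pointDiff y x = -pointDiff x y := by ext i; simp [pointDiff]
    rw [this]
    exact neg_mem ih
  | trans x y z _ _ ih1 ih2 =>
    have : pointDiff x z = pointDiff x y + pointDiff y z := by ext i; simp [pointDiff]
    rw [this]
    exact add_mem ih1 ih2

/-- A Markov basis generates the lattice. -/
lemma IsMarkovBasis.mem_span {K : Type*} [Field K] {n : ℕ} {A : Matrix (Fin 1) (Fin n) ℤ}
    {B : Set (Fin n → ℤ)} (hB : IsMarkovBasis K A B) {z : Fin n → ℤ} (hz : z ∈ latticeKer A) :
    z ∈ Submodule.span ℤ B := by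
  rw [← pointDiff_natPos z]
  exact (hB.moveConn (weight_natPos hz)).pointDiff_mem_span

/-- The points `x` and `y` are the two parts of the move `u`, in one of the two orders. -/
def Joins {n : ℕ} (u : Fin n → ℤ) (x y : Fin n →₀ ℕ) : Prop :=
  (x = natPos u ∧ y = natPos (-u)) ∨ (x = natPos (-u) ∧ y = natPos u)

lemma Joins.symm {n : ℕ} {u : Fin n → ℤ} {x y : Fin n →₀ ℕ} (h : Joins u x y) : Joins u y x :=
  (Or.symm h).imp And.symm And.symm

lemma joins_natPos {n : ℕ} (u : Fin n → ℤ) : Joins u (natPos u) (natPos (-u)) := .inl ⟨rfl, rfl⟩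

lemma Joins.disjoint {n : ℕ} {u : Fin n → ℤ} {x y : Fin n →₀ ℕ} (h : Joins u x y) (i : Fin n) :
    x i = 0 ∨ y i = 0 := by
  rcases h with ⟨rfl, rfl⟩ | ⟨rfl, rfl⟩ <;> simp <;> omega

lemma Joins.weight_eq {n : ℕ} {A : Matrix (Fin 1) (Fin n) ℤ} {u : Fin n → ℤ}
    (hu : u ∈ latticeKer A) {x y : Fin n →₀ ℕ} (h : Joins u x y) :
    weight A x = weight A (natPos u) ∧ weight A y = weight A (natPos u) := by
  rcases h with ⟨rfl, rfl⟩ | ⟨rfl, rfl⟩ <;> simp [weight_natPos hu]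

lemma Joins.moveConn {n : ℕ} {B : Set (Fin n → ℤ)} {u : Fin n → ℤ} (hu : u ∈ B)
    {x y : Fin n →₀ ℕ} (h : Joins u x y) : MoveConn B x y := by
  rcases h with ⟨rfl, rfl⟩ | ⟨rfl, rfl⟩
  · exact .rel _ _ ⟨u, hu, 0, by simp, by simp⟩
  · exact .symm _ _ (.rel _ _ ⟨u, hu, 0, by simp, by simp⟩)

lemma Joins.eq_pointDiff {n : ℕ} {u : Fin n → ℤ} {x y : Fin n →₀ ℕ} (h : Joins u x y) :
    ∃ ε : ℤˣ, u = ε • pointDiff x y := by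
  rcases h with ⟨rfl, rfl⟩ | ⟨rfl, rfl⟩
  · exact ⟨1, by simp [pointDiff_natPos]⟩
  · refine ⟨-1, ?_⟩
    have := pointDiff_natPos (-u)
    rw [neg_neg] at this
    rw [this]
    ext i
    simp

/-- `c` is the least multiplicity for which the fibre of `c eᵢ` has a second point. -/
structure IsCritical {n : ℕ} (A : Matrix (Fin 1) (Fin n) ℤ) (i : Fin n) (c : ℕ) : Prop where
  exists_ne : ∃ y, weight A y = weight A (Finsupp.single i c) ∧ y ≠ Finsupp.single i c
  eq_of_lt : ∀ c' < c, ∀ y, weight A y = weight A (Finsupp.single i c') → y = Finsupp.single i c'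

lemma exists_isCritical {n : ℕ} {A : Matrix (Fin 1) (Fin n) ℤ} (hpos : ∀ j, 0 < A 0 j)
    {i j : Fin n} (hij : i ≠ j) : ∃ c, IsCritical A i c := by
  classical
  have h : ∃ c, ∃ y, weight A y = weight A (Finsupp.single i c) ∧ y ≠ Finsupp.single i c := by
    refine ⟨(A 0 j).toNat, Finsupp.single j (A 0 i).toNat, ?_, fun h => ?_⟩
    · have hi := hpos i
      have hj := hpos j
      rw [weight_single, weight_single, Int.toNat_of_nonneg hi.le, Int.toNat_of_nonneg hj.le,
        mul_comm]
    · have := DFunLike.congr_fun h j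
      have hi := hpos i
      rw [Finsupp.single_eq_same, Finsupp.single_eq_of_ne hij.symm] at this
      omega
  refine ⟨Nat.find h, Nat.find_spec h, fun c' hc' y hy => ?_⟩
  by_contra hne
  exact Nat.find_min h hc' ⟨y, hy, hne⟩

section Critical

variable {n : ℕ} {A : Matrix (Fin 1) (Fin n) ℤ} {i : Fin n} {c : ℕ}

lemma IsCritical.le (hc : IsCritical A i c) {m : ℕ} {y : Fin n →₀ ℕ}
    (hy : weight A y = weight A (Finsupp.single i m)) (hne : y ≠ Finsupp.single i m) : c ≤ m := by
  by_contra h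
  exact hne (hc.eq_of_lt m (not_le.1 h) y hy)

lemma IsCritical.exists_disjoint (hpos : ∀ j, 0 < A 0 j) (hc : IsCritical A i c) :
    0 < c ∧ ∃ y, weight A y = weight A (Finsupp.single i c) ∧ y i = 0 ∧ ∃ j, y j ≠ 0 := by
  classical
  obtain ⟨y, hy, hne⟩ := hc.exists_ne
  have hc0 : 0 < c := by
    rcases Nat.eq_zero_or_pos c with rfl | h
    · exact absurd (eq_zero_of_weight hpos (hy.trans (by rw [weight_single]; simp)))
        (by simpa using hne)
    · exact h
  refine ⟨hc0, y, hy, ?_, ?_⟩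
  · by_contra hyi
    have key : Finsupp.single i 1 + (y - Finsupp.single i 1) = y :=
      add_tsub_cancel_of_le (Finsupp.single_le_iff.2 (Nat.one_le_iff_ne_zero.2 hyi))
    obtain ⟨k, rfl⟩ : ∃ k, c = 1 + k := ⟨c - 1, by omega⟩
    rw [← key, weight_add, Finsupp.single_add, weight_add] at hy
    have := hc.eq_of_lt k (by omega) _ (add_left_cancel hy)
    exact hne (by rw [← key, this, Finsupp.single_add])
  · by_contra! h
    have : y = 0 := by ext j; exact h j
    rw [this, weight_single] at hy
    have h1 := hpos i
    have h2 : weight A (0 : Fin n →₀ ℕ) = 0 := by simp [weight]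
    rw [h2] at hy
    have : 0 < A 0 i * (c : ℤ) := by positivity
    omega

/-- Above the critical multiplicity, a point on an axis has a companion of larger support. -/
lemma IsCritical.exists_of_lt (hpos : ∀ j, 0 < A 0 j) (hc : IsCritical A i c) {m : ℕ}
    (hm : c < m) : ∃ y, weight A y = weight A (Finsupp.single i m) ∧ y i ≠ 0 ∧
      ∃ j, j ≠ i ∧ y j ≠ 0 := by
  obtain ⟨-, p, hp, hpi, j, hj⟩ := hc.exists_disjoint hpos
  have hji : j ≠ i := by rintro rfl; exact hj hpi
  refine ⟨Finsupp.single i (m - c) + p, ?_, ?_, j, hji, ?_⟩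
  · rw [weight_add, hp, ← weight_add, ← Finsupp.single_add, Nat.sub_add_cancel hm.le]
  · simp [hpi]
    omega
  · simp [hj]

end Critical

lemma exists_third {i j : Fin 3} (hij : i ≠ j) :
    ∃ k, k ≠ i ∧ k ≠ j ∧ ∀ l, l = i ∨ l = j ∨ l = k := by
  decide +revert

lemma eq_single_of_cover {i j k : Fin 3} (h : ∀ l, l = i ∨ l = j ∨ l = k) {y : Fin 3 →₀ ℕ}
    (hi : y i = 0) (hj : y j = 0) : y = Finsupp.single k (y k) := by
  classical
  ext l
  rcases h l with rfl | rfl | rfl <;> simp [Finsupp.single_apply] <;> aesop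

/-- The combinatorial properties of a minimal Markov basis `M` of a row of three positive
integers, where `C i` is the critical multiplicity of the coordinate `i`. -/
structure MinimalMoves (A : Matrix (Fin 1) (Fin 3) ℤ) (M : Set (Fin 3 → ℤ)) (C : Fin 3 → ℕ) :
    Prop where
  pos : ∀ j, 0 < A 0 j
  critical : ∀ i, IsCritical A i (C i)
  subset : M ⊆ (latticeKer A : Set (Fin 3 → ℤ))
  conn : ∀ {x y}, weight A x = weight A y → MoveConn M x y
  not_conn : ∀ {u}, u ∈ M → ∀ {x y}, Joins u x y → ¬ MoveConn (M \ {u}) x y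
  share : ∀ {u}, u ∈ M → ∀ {x y}, weight A x = weight A (natPos u) → weight A x = weight A y →
    ∀ {i}, x i ≠ 0 → y i ≠ 0 → MoveConn (M \ {u}) x y

lemma IsMinimalMarkovBasis.exists_minimalMoves {K : Type*} [Field K]
    {A : Matrix (Fin 1) (Fin 3) ℤ} (hpos : ∀ j, 0 < A 0 j) {M : Set (Fin 3 → ℤ)}
    (hM : IsMinimalMarkovBasis K A M) : ∃ C, MinimalMoves A M C := by
  have h : ∀ i : Fin 3, ∃ c, IsCritical A i c := fun i =>
    exists_isCritical hpos (j := i + 1) (by decide +revert)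
  choose C hC using h
  refine ⟨C, hpos, hC, hM.1.1, hM.1.moveConn, ?_, fun _ _ _ hx hxy _ =>
    hM.1.moveConn_diff hpos hx hxy⟩
  rintro u hu x y (⟨rfl, rfl⟩ | ⟨rfl, rfl⟩) h
  · exact hM.not_moveConn hu h
  · exact hM.not_moveConn hu (.symm _ _ h)

namespace MinimalMoves

variable {A : Matrix (Fin 1) (Fin 3) ℤ} {M : Set (Fin 3 → ℤ)} {C : Fin 3 → ℕ}

lemma C_pos (h : MinimalMoves A M C) (i : Fin 3) : 0 < C i :=
  ((h.critical i).exists_disjoint h.pos).1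

lemma exists_ne_zero (h : MinimalMoves A M C) {u : Fin 3 → ℤ} (hu : u ∈ M) {x y : Fin 3 →₀ ℕ}
    (hj : Joins u x y) : ∃ j, x j ≠ 0 := by
  by_contra! h0
  have hx : x = 0 := by ext j; exact h0 j
  have hw := hj.weight_eq (h.subset hu)
  have hy : y = 0 := eq_zero_of_weight h.pos (by rw [hw.2, ← hw.1, hx]; simp [weight])
  exact h.not_conn hu hj (by rw [hx, hy]; exact .refl _)

/-- A move with a part on an axis has a critical part. -/
lemma exists_joins_of_single (h : MinimalMoves A M C) {u : Fin 3 → ℤ} (hu : u ∈ M) {i : Fin 3}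
    {m : ℕ} {y : Fin 3 →₀ ℕ} (hj : Joins u (Finsupp.single i m) y) :
    ∃ i y, Joins u (Finsupp.single i (C i)) y := by
  have hw := hj.weight_eq (h.subset hu)
  have hne : y ≠ Finsupp.single i m := by
    rintro rfl
    exact h.not_conn hu hj (.refl _)
  obtain hlt | heq := ((h.critical i).le (hw.2.trans hw.1.symm) hne).lt_or_eq
  swap
  · exact ⟨i, y, heq ▸ hj⟩
  obtain ⟨x', hx', hxi, j, hji, hxj⟩ := (h.critical i).exists_of_lt h.pos hlt
  have hm : (Finsupp.single i m : Fin 3 →₀ ℕ) i ≠ 0 := by simp; omega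
  have hyi : y i = 0 := (hj.disjoint i).resolve_left hm
  have hxx : MoveConn (M \ {u}) (Finsupp.single i m) x' := h.share hu hw.1 hx'.symm hm hxi
  have hno : ¬ MoveConn (M \ {u}) x' y := fun h' => h.not_conn hu hj (.trans _ _ _ hxx h')
  have hx'w := hx'.trans hw.1
  have hyj : y j = 0 := by
    by_contra hyj
    exact hno (h.share hu hx'w (hx'w.trans hw.2.symm) hxj hyj)
  obtain ⟨k, hki, hkj, hcov⟩ := exists_third hji.symm
  have hyk := eq_single_of_cover hcov hyi hyj
  rw [hyk] at hw
  have hyk0 : y k ≠ 0 := by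
    obtain ⟨l, hl⟩ := h.exists_ne_zero hu hj.symm
    rcases hcov l with rfl | rfl | rfl
    exacts [absurd hyi hl, absurd hyj hl, hl]
  have hne' : Finsupp.single i m ≠ Finsupp.single k (y k) := by
    rw [← hyk]
    exact hne.symm
  obtain hlt' | heq' := ((h.critical k).le (hw.1.trans hw.2.symm) hne').lt_or_eq
  swap
  · refine ⟨k, Finsupp.single i m, ?_⟩
    rw [heq', ← hyk]
    exact hj.symm
  obtain ⟨y', hy', hyk', l, hlk, hyl⟩ := (h.critical k).exists_of_lt h.pos hlt'
  have hyy : MoveConn (M \ {u}) y y' := by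
    rw [← hyk] at hw hy'
    exact h.share hu hw.2 hy'.symm hyk0 hyk'
  refine absurd (Relation.EqvGen.trans _ _ _ ?_ (.symm _ _ hyy)) hno
  have hw' := hx'w.trans (hy'.trans hw.2).symm
  rcases hcov l with rfl | rfl | rfl
  · exact h.share hu hx'w hw' hxi hyl
  · exact h.share hu hx'w hw' hxj hyl
  · exact absurd rfl hlk

lemma exists_joins (h : MinimalMoves A M C) {u : Fin 3 → ℤ} (hu : u ∈ M) :
    ∃ i y, Joins u (Finsupp.single i (C i)) y := by
  have hd : ∀ i, natPos u i = 0 ∨ natPos (-u) i = 0 := (joins_natPos u).disjoint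
  have key : ∃ x y k m, Joins u x y ∧ x = Finsupp.single k m := by
    have h0 := hd 0
    have h1 := hd 1
    have h2 := hd 2
    have c0 : ∀ l : Fin 3, l = 1 ∨ l = 2 ∨ l = 0 := by decide
    have c1 : ∀ l : Fin 3, l = 0 ∨ l = 2 ∨ l = 1 := by decide
    have c2 : ∀ l : Fin 3, l = 0 ∨ l = 1 ∨ l = 2 := by decide
    have hJ := joins_natPos u
    rcases h0 with h0 | h0 <;> rcases h1 with h1 | h1 <;> rcases h2 with h2 | h2
    · exact ⟨_, _, _, _, hJ, eq_single_of_cover c2 h0 h1⟩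
    · exact ⟨_, _, _, _, hJ, eq_single_of_cover c2 h0 h1⟩
    · exact ⟨_, _, _, _, hJ, eq_single_of_cover c1 h0 h2⟩
    · exact ⟨_, _, _, _, hJ.symm, eq_single_of_cover c0 h1 h2⟩
    · exact ⟨_, _, _, _, hJ, eq_single_of_cover c0 h1 h2⟩
    · exact ⟨_, _, _, _, hJ.symm, eq_single_of_cover c1 h0 h2⟩
    · exact ⟨_, _, _, _, hJ.symm, eq_single_of_cover c2 h0 h1⟩
    · exact ⟨_, _, _, _, hJ.symm, eq_single_of_cover c2 h0 h1⟩
  obtain ⟨x, y, k, m, hJ, rfl⟩ := key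
  exact h.exists_joins_of_single hu hJ

/-- Every coordinate is the type of some move. -/
lemma exists_move (h : MinimalMoves A M C) (i : Fin 3) :
    ∃ u ∈ M, ∃ y, Joins u (Finsupp.single i (C i)) y := by
  obtain ⟨p, hp, hne⟩ := (h.critical i).exists_ne
  obtain heq | ⟨⟨u, hu, hle⟩, -⟩ := (h.conn hp.symm).exists_le
  · exact absurd heq.symm hne
  obtain ⟨x, y, hJ, hle⟩ : ∃ x y, Joins u x y ∧ x ≤ Finsupp.single i (C i) := by
    rcases hle with hle | hle
    · exact ⟨_, _, joins_natPos u, hle⟩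
    · exact ⟨_, _, (joins_natPos u).symm, hle⟩
  have hx : x = Finsupp.single i (x i) := by
    ext l
    rcases eq_or_ne l i with rfl | hl
    · simp
    · have := hle l
      rw [Finsupp.single_eq_of_ne hl] at this ⊢
      omega
  have hw := hJ.weight_eq (h.subset hu)
  have hle' : x i ≤ C i := by simpa using hle i
  have hyx : y ≠ Finsupp.single i (x i) := by
    rw [← hx]
    rintro rfl
    exact h.not_conn hu hJ (.refl _)
  have hge := (h.critical i).le (by rw [← hx, hw.1, hw.2]) hyx
  refine ⟨u, hu, y, ?_⟩
  rw [← le_antisymm hle' hge, ← hx]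
  exact hJ

/-- Two distinct moves of the same type join the axis point of that type to the two other
critical axis points. -/
lemma joins_eq_single (h : MinimalMoves A M C) {u v : Fin 3 → ℤ} (hu : u ∈ M) (hv : v ∈ M)
    (huv : u ≠ v) {i : Fin 3} {x y : Fin 3 →₀ ℕ} (hx : Joins u (Finsupp.single i (C i)) x)
    (hy : Joins v (Finsupp.single i (C i)) y) :
    ∃ j k, j ≠ i ∧ k ≠ i ∧ j ≠ k ∧ x = Finsupp.single j (C j) ∧ y = Finsupp.single k (y k) := by
  have hxw := hx.weight_eq (h.subset hu)
  have hyw := hy.weight_eq (h.subset hv)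
  have hCi : (Finsupp.single i (C i) : Fin 3 →₀ ℕ) i ≠ 0 := by simpa using (h.C_pos i).ne'
  have hvsx : MoveConn (M \ {v}) (Finsupp.single i (C i)) x :=
    Joins.moveConn (B := M \ {v}) ⟨hu, huv⟩ hx
  have hsy := h.not_conn hv hy
  have hvxy : ¬ MoveConn (M \ {v}) x y := fun h' => hsy (.trans _ _ _ hvsx h')
  have hxi : x i = 0 := (hx.disjoint i).resolve_left hCi
  have hyi : y i = 0 := (hy.disjoint i).resolve_left hCi
  have hxv : weight A x = weight A (natPos v) := by rw [hxw.2, ← hxw.1, hyw.1]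
  have hdis : ∀ l, x l ≠ 0 → y l ≠ 0 → False := fun l h1 h2 =>
    hvxy (h.share hv hxv (hxv.trans hyw.2.symm) h1 h2)
  obtain ⟨j, hxj⟩ := h.exists_ne_zero hu hx.symm
  obtain ⟨k, hyk⟩ := h.exists_ne_zero hv hy.symm
  have hji : j ≠ i := by rintro rfl; exact hxj hxi
  have hki : k ≠ i := by rintro rfl; exact hyk hyi
  have hjk : j ≠ k := by rintro rfl; exact hdis _ hxj hyk
  have hcov : ∀ l, l = i ∨ l = j ∨ l = k := by
    clear * - hji hki hjk
    decide +revert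
  have hcov' : ∀ l, l = i ∨ l = k ∨ l = j := fun l => (hcov l).imp_right Or.symm
  have hx1 := eq_single_of_cover hcov' hxi (by by_contra h'; exact hdis _ h' hyk)
  have hy1 := eq_single_of_cover hcov hyi (by by_contra h'; exact hdis _ hxj h')
  refine ⟨j, k, hji, hki, hjk, ?_, hy1⟩
  have hle := (h.critical j).le (y := Finsupp.single i (C i)) (by rw [← hx1, hxw.1, hxw.2])
    (fun h' => h.not_conn hu hx (by rw [h', ← hx1]; exact .refl _))
  obtain hlt | heq := hle.lt_or_eq
  swap
  · rw [heq, ← hx1]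
  exfalso
  obtain ⟨x', hx', hxj', l, hlj, hxl⟩ := (h.critical j).exists_of_lt h.pos hlt
  rw [← hx1] at hx'
  rcases hcov l with rfl | rfl | rfl
  · refine h.not_conn hu hx (.trans _ x' _ ?_ ?_)
    · exact h.share hu hxw.1 (by rw [hx', hxw.1, hxw.2]) hCi hxl
    · exact h.share hu (hx'.trans hxw.2) hx' hxj' hxj
  · exact hlj rfl
  · refine hvxy (.trans _ x' _ ?_ ?_)
    · exact h.share hv hxv hx'.symm hxj hxj'
    · exact h.share hv (hx'.trans hxv) (by rw [hx', hxv, hyw.2]) hxl hyk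

lemma joins_single_single (h : MinimalMoves A M C) {u v : Fin 3 → ℤ} (hu : u ∈ M) (hv : v ∈ M)
    (huv : u ≠ v) {i : Fin 3} {x y : Fin 3 →₀ ℕ} (hx : Joins u (Finsupp.single i (C i)) x)
    (hy : Joins v (Finsupp.single i (C i)) y) :
    ∃ j k, j ≠ i ∧ k ≠ i ∧ j ≠ k ∧ x = Finsupp.single j (C j) ∧ y = Finsupp.single k (C k) := by
  obtain ⟨j, k, hji, hki, hjk, hx1, -⟩ := h.joins_eq_single hu hv huv hx hy
  obtain ⟨k', j', hki', hji', hjk', hy1, hx2⟩ := h.joins_eq_single hv hu huv.symm hy hx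
  have : j' = j := by
    by_contra hne
    have := DFunLike.congr_fun (hx1.symm.trans hx2) j
    rw [Finsupp.single_eq_same, Finsupp.single_eq_of_ne (Ne.symm hne)] at this
    exact (h.C_pos j).ne' this
  subst this
  exact ⟨j', k', hji, hki', hjk'.symm, hx1, hy1⟩

end MinimalMoves

lemma relabel_apply (ρ : Equiv.Perm (Fin 3)) (w : Fin 3 → ℤ) (s : Fin 3) :
    relabel ρ w (ρ s) = w s := by
  simp [relabel]

lemma eq_relabel_iff {ρ : Equiv.Perm (Fin 3)} {w z : Fin 3 → ℤ} :
    z = relabel ρ w ↔ ∀ s, z (ρ s) = w s := by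
  refine ⟨fun h s => by rw [h, relabel_apply], fun h => funext fun t => ?_⟩
  obtain ⟨s, rfl⟩ := ρ.surjective t
  rw [h, relabel_apply]

lemma exists_perm {i j k : Fin 3} (hij : i ≠ j) (hik : i ≠ k) (hjk : j ≠ k) :
    ∃ ρ : Equiv.Perm (Fin 3), ρ 0 = i ∧ ρ 1 = j ∧ ρ 2 = k := by
  decide +revert

namespace MinimalMoves

variable {A : Matrix (Fin 1) (Fin 3) ℤ} {M : Set (Fin 3 → ℤ)} {C : Fin 3 → ℕ}

lemma C_ne_zero (h : MinimalMoves A M C) (i : Fin 3) :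
    (Finsupp.single i (C i) : Fin 3 →₀ ℕ) i ≠ 0 := by
  simpa using (h.C_pos i).ne'

/-- If a move joins two critical axis points, then there are only two moves. -/
lemma eq_pair (h : MinimalMoves A M C) {u v : Fin 3 → ℤ} (hu : u ∈ M) (hv : v ∈ M)
    {i j k : Fin 3} (hij : i ≠ j) (hki : k ≠ i) (hkj : k ≠ j) {w : Fin 3 →₀ ℕ}
    (hJu : Joins u (Finsupp.single i (C i)) (Finsupp.single j (C j)))
    (hJv : Joins v (Finsupp.single k (C k)) w) : M = {u, v} := by
  have hcov : ∀ l, l = i ∨ l = j ∨ l = k := by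
    clear * - hij hki hkj
    decide +revert
  have notk : ∀ v' ∈ M, ∀ y, Joins v' (Finsupp.single k (C k)) y → v' ≠ u := by
    rintro v' hv' y hJ rfl
    have hw := hJ.disjoint k
    have := h.C_ne_zero k
    rcases hJ with ⟨h1, -⟩ | ⟨h1, -⟩ <;> rcases hJu with ⟨h2, h3⟩ | ⟨h2, h3⟩ <;>
      rw [h1] at this <;> first | rw [← h2] at this | rw [← h3] at this
    all_goals simp [hki, hkj] at this
  have casek : ∀ v' ∈ M, ∀ y, Joins v' (Finsupp.single k (C k)) y → v' = v := by
    intro v' hv' y hJ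
    by_contra hne
    have h1 := notk v' hv' y hJ
    have h2 := notk v hv w hJv
    obtain ⟨p, q, hp, hq, hpq, rfl, rfl⟩ := h.joins_single_single hv' hv hne hJ hJv
    have c1 : MoveConn (M \ {u}) (Finsupp.single k (C k)) (Finsupp.single p (C p)) :=
      Joins.moveConn (B := M \ {u}) ⟨hv', h1⟩ hJ
    have c2 : MoveConn (M \ {u}) (Finsupp.single k (C k)) (Finsupp.single q (C q)) :=
      Joins.moveConn (B := M \ {u}) ⟨hv, h2⟩ hJv
    have c3 := Relation.EqvGen.trans _ _ _ (.symm _ _ c1) c2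
    have hpq' : (p = i ∧ q = j) ∨ (p = j ∧ q = i) := by
      clear * - hp hq hpq hij hki hkj
      decide +revert
    rcases hpq' with ⟨rfl, rfl⟩ | ⟨rfl, rfl⟩
    · exact h.not_conn hu hJu c3
    · exact h.not_conn hu hJu (.symm _ _ c3)
  have caseij : ∀ p q, p ≠ k → q ≠ k → p ≠ q →
      Joins u (Finsupp.single p (C p)) (Finsupp.single q (C q)) →
      ∀ v' ∈ M, ∀ y, Joins v' (Finsupp.single p (C p)) y → v' = u ∨ v' = v := by
    intro p q hp hq hpq hJ v' hv' y hJ'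
    by_contra! hne
    obtain ⟨q', k', hq', hk', hqk, he, rfl⟩ := h.joins_single_single hu hv' hne.1.symm hJ hJ'
    have : q = q' := by
      by_contra hq
      have := DFunLike.congr_fun he q
      rw [Finsupp.single_eq_same, Finsupp.single_eq_of_ne hq] at this
      exact (h.C_pos q).ne' this
    subst this
    have : k = k' := by
      clear * - hp hq hpq hk' hqk
      omega
    subst this
    exact hne.2 (casek v' hv' _ hJ'.symm)
  refine Set.Subset.antisymm (fun v' hv' => ?_)
    (Set.insert_subset hu (Set.singleton_subset_iff.2 hv))
  obtain ⟨l, y, hJ⟩ := h.exists_joins hv'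
  rcases hcov l with rfl | rfl | rfl
  · exact caseij _ _ hki.symm hkj.symm hij hJu v' hv' y hJ
  · exact caseij _ _ hkj.symm hki.symm hij.symm hJu.symm v' hv' y hJ
  · exact .inr (casek v' hv' y hJ)

lemma exists_hasCIForm (h : MinimalMoves A M C) (hdist : Function.Injective (A 0))
    {u : Fin 3 → ℤ} (hu : u ∈ M) {i j : Fin 3} (hij : i ≠ j)
    (hJu : Joins u (Finsupp.single i (C i)) (Finsupp.single j (C j))) :
    ∃ (ρ : Equiv.Perm (Fin 3)) (b₁ b₂ c₁ c₂ c₃ : ℤ), HasCIForm M ρ b₁ b₂ c₁ c₂ c₃ := by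
  wlog hlt : C j < C i generalizing i j
  · refine this hij.symm hJu.symm (lt_of_le_of_ne (not_lt.1 hlt) fun heq => hij (hdist ?_))
    have hw := hJu.weight_eq (h.subset hu)
    have := hw.1.trans hw.2.symm
    rw [weight_single, weight_single, heq] at this
    exact mul_right_cancel₀ (by exact_mod_cast (h.C_pos j).ne') this
  obtain ⟨k, hki, hkj, hcov⟩ := exists_third hij
  obtain ⟨v, hv, w, hJv⟩ := h.exists_move k
  have hwk : w k = 0 := (hJv.disjoint k).resolve_left (h.C_ne_zero k)
  have hM := h.eq_pair hu hv hij hki hkj hJu hJv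
  obtain ⟨ρ, rfl, rfl, rfl⟩ := exists_perm hij hki.symm hkj.symm
  obtain ⟨ε₁, hε₁⟩ := hJu.eq_pointDiff
  obtain ⟨ε₂, hε₂⟩ := hJv.symm.eq_pointDiff
  refine ⟨ρ, C (ρ 0), C (ρ 1), w (ρ 0), w (ρ 1), C (ρ 2), by exact_mod_cast h.C_pos _,
    by exact_mod_cast hlt, by positivity, by positivity, by exact_mod_cast h.C_pos _, ε₁, ε₂, ?_⟩
  have e1 : pointDiff (Finsupp.single (ρ 0) (C (ρ 0))) (Finsupp.single (ρ 1) (C (ρ 1))) =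
      relabel ρ ![(C (ρ 0) : ℤ), -(C (ρ 1) : ℤ), 0] := by
    rw [eq_relabel_iff]
    intro s
    fin_cases s <;> simp [pointDiff]
  have e2 : pointDiff w (Finsupp.single (ρ 2) (C (ρ 2))) =
      relabel ρ ![(w (ρ 0) : ℤ), (w (ρ 1) : ℤ), -(C (ρ 2) : ℤ)] := by
    rw [eq_relabel_iff]
    intro s
    fin_cases s <;> simp [pointDiff, hwk]
  rw [hM, hε₁, hε₂, e1, e2]

/-- If no move joins two critical axis points, a second part of a move is not on an axis. -/
lemma exists_full_support (h : MinimalMoves A M C)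
    (hno : ∀ u ∈ M, ∀ i j, i ≠ j → ¬ Joins u (Finsupp.single i (C i)) (Finsupp.single j (C j)))
    {u : Fin 3 → Fin 3 → ℤ} (hu : ∀ i, u i ∈ M) {w : Fin 3 → Fin 3 →₀ ℕ}
    (hJ : ∀ i, Joins (u i) (Finsupp.single i (C i)) (w i)) {i k : Fin 3} (hik : i ≠ k) :
    w i k ≠ 0 := by
  have hself : ∀ i, w i i = 0 := fun i => ((hJ i).disjoint i).resolve_left (h.C_ne_zero i)
  have step : ∀ i j k, i ≠ j → i ≠ k → j ≠ k → w i k = 0 →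
      w j i = 0 ∧ A 0 j * (C j : ℤ) < A 0 i * (C i : ℤ) := by
    intro i j k hij hik hjk h0
    have hcov : ∀ l, l = i ∨ l = k ∨ l = j := by
      clear * - hij hik hjk
      decide +revert
    have hw := (hJ i).weight_eq (h.subset (hu i))
    have hwi := eq_single_of_cover hcov (hself i) h0
    have hne : Finsupp.single i (C i) ≠ w i := fun he =>
      h.not_conn (hu i) (hJ i) (he ▸ .refl _)
    have hle := (h.critical j).le (m := w i j) (y := Finsupp.single i (C i))
      (by rw [← hwi, hw.1, hw.2]) (by rw [← hwi]; exact hne)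
    have hlt : C j < w i j := by
      refine lt_of_le_of_ne hle fun he => hno _ (hu i) i j hij ?_
      rw [he, ← hwi]
      exact hJ i
    have hwj := (hJ j).weight_eq (h.subset (hu j))
    have hx' : weight A (Finsupp.single j (w i j - C j) + w j) = weight A (w i) := by
      rw [weight_add, hwj.2, ← hwj.1, ← weight_add, ← Finsupp.single_add,
        Nat.sub_add_cancel hle, ← hwi]
    refine ⟨?_, ?_⟩
    · by_contra hji
      refine h.not_conn (hu i) (hJ i)
        (.trans _ (Finsupp.single j (w i j - C j) + w j) _ (h.share (hu i) hw.1 ?_ (i := i) ?_ ?_)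
          (h.share (hu i) (hx'.trans hw.2) hx' (i := j) ?_ ?_))
      · rw [hx', hw.1, hw.2]
      · exact h.C_ne_zero i
      · simp [hji]
      · simp
        omega
      · omega
    · have e := hw.1.trans hw.2.symm
      rw [hwi, weight_single, weight_single] at e
      rw [e]
      have := h.pos j
      gcongr
  intro h0
  obtain ⟨j, hji, hjk, -⟩ := exists_third hik
  obtain ⟨h1, l1⟩ := step i j k hji.symm hik hjk h0
  obtain ⟨h2, l2⟩ := step j k i hjk hji hik.symm h1
  obtain ⟨-, l3⟩ := step k i j hik.symm hjk.symm hji.symm h2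
  exact lt_irrefl _ (l1.trans (l3.trans l2))

lemma exists_hasNonCIForm (h : MinimalMoves A M C)
    (hno : ∀ u ∈ M, ∀ i j, i ≠ j → ¬ Joins u (Finsupp.single i (C i)) (Finsupp.single j (C j)))
    (ρ : Equiv.Perm (Fin 3)) : ∃ c₁ c₂ c₃ v₁₂ v₁₃ v₂₁ v₂₃ v₃₁ v₃₂ : ℤ,
      HasNonCIForm M ρ c₁ c₂ c₃ v₁₂ v₁₃ v₂₁ v₂₃ v₃₁ v₃₂ := by
  choose u hu w hJ using h.exists_move
  have hfull : ∀ {i k}, i ≠ k → w i k ≠ 0 := h.exists_full_support hno hu hJ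
  have hself : ∀ i, w i i = 0 := fun i => ((hJ i).disjoint i).resolve_left (h.C_ne_zero i)
  have hM : M = {u (ρ 0), u (ρ 1), u (ρ 2)} := by
    ext v
    constructor
    · intro hv
      obtain ⟨i, y, hy⟩ := h.exists_joins hv
      have : v = u i := by
        by_contra hne
        obtain ⟨j, k, hji, -, -, rfl, -⟩ := h.joins_single_single hv (hu i) hne hy (hJ i)
        exact hno v hv i j hji.symm hy
      obtain ⟨s, rfl⟩ := ρ.surjective i
      rw [this]
      fin_cases s <;> simp
    · rintro (rfl | rfl | rfl) <;> exact hu _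
  choose ε hε using fun i => (hJ i).symm.eq_pointDiff
  have hpos : ∀ {s t}, s ≠ t → (0 : ℤ) < w (ρ s) (ρ t) := fun hst => by
    have := hfull (ρ.injective.ne hst)
    omega
  have hC : ∀ i, (0 : ℤ) < C i := fun i => by exact_mod_cast h.C_pos i
  refine ⟨C (ρ 0), C (ρ 1), C (ρ 2), w (ρ 0) (ρ 1), w (ρ 0) (ρ 2), w (ρ 1) (ρ 0), w (ρ 1) (ρ 2),
    w (ρ 2) (ρ 0), w (ρ 2) (ρ 1), hC _, hC _, hC _, hpos (by decide), hpos (by decide),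
    hpos (by decide), hpos (by decide), hpos (by decide), hpos (by decide),
    ε (ρ 0), ε (ρ 1), ε (ρ 2), ?_⟩
  have e0 : pointDiff (w (ρ 0)) (Finsupp.single (ρ 0) (C (ρ 0))) =
      relabel ρ ![-(C (ρ 0) : ℤ), (w (ρ 0) (ρ 1) : ℤ), (w (ρ 0) (ρ 2) : ℤ)] := by
    rw [eq_relabel_iff]
    intro s
    fin_cases s <;> simp [pointDiff, hself]
  have e1 : pointDiff (w (ρ 1)) (Finsupp.single (ρ 1) (C (ρ 1))) =
      relabel ρ ![(w (ρ 1) (ρ 0) : ℤ), -(C (ρ 1) : ℤ), (w (ρ 1) (ρ 2) : ℤ)] := by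
    rw [eq_relabel_iff]
    intro s
    fin_cases s <;> simp [pointDiff, hself]
  have e2 : pointDiff (w (ρ 2)) (Finsupp.single (ρ 2) (C (ρ 2))) =
      relabel ρ ![(w (ρ 2) (ρ 0) : ℤ), (w (ρ 2) (ρ 1) : ℤ), -(C (ρ 2) : ℤ)] := by
    rw [eq_relabel_iff]
    intro s
    fin_cases s <;> simp [pointDiff, hself]
  rw [hM, hε (ρ 0), hε (ρ 1), hε (ρ 2), e0, e1, e2]

end MinimalMoves

/-- A minimal Markov basis has one of the two forms. -/
lemma IsMinimalMarkovBasis.form {K : Type*} [Field K]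
    {A : Matrix (Fin 1) (Fin 3) ℤ} (hpos : ∀ j, 0 < A 0 j) (hdist : Function.Injective (A 0))
    {M : Set (Fin 3 → ℤ)} (hM : IsMinimalMarkovBasis K A M) :
    (∃ (ρ : Equiv.Perm (Fin 3)) (b₁ b₂ c₁ c₂ c₃ : ℤ), HasCIForm M ρ b₁ b₂ c₁ c₂ c₃) ∨
    ∀ ρ : Equiv.Perm (Fin 3), ∃ c₁ c₂ c₃ v₁₂ v₁₃ v₂₁ v₂₃ v₃₁ v₃₂ : ℤ,
      HasNonCIForm M ρ c₁ c₂ c₃ v₁₂ v₁₃ v₂₁ v₂₃ v₃₁ v₃₂ := by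
  obtain ⟨C, h⟩ := hM.exists_minimalMoves hpos
  by_cases hA : ∃ u ∈ M, ∃ i j, i ≠ j ∧ Joins u (Finsupp.single i (C i)) (Finsupp.single j (C j))
  · obtain ⟨u, hu, i, j, hij, hJ⟩ := hA
    exact .inl (h.exists_hasCIForm hdist hu hij hJ)
  · push Not at hA
    exact .inr (h.exists_hasNonCIForm hA)

lemma finrank_latticeKer {A : Matrix (Fin 1) (Fin 3) ℤ} (hpos : ∀ j, 0 < A 0 j) :
    Module.finrank ℤ (latticeKer A) = 2 := by
  have h1 := Submodule.finrank_quotient_add_finrank (LinearMap.ker A.mulVecLin)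
  rw [A.mulVecLin.quotKerEquivRange.finrank_eq] at h1
  have h2 : Module.finrank ℤ (LinearMap.range A.mulVecLin) ≤ 1 := by
    simpa using Submodule.finrank_le (LinearMap.range A.mulVecLin)
  have h3 : Module.finrank ℤ (LinearMap.range A.mulVecLin) ≠ 0 := by
    intro h0
    rw [Submodule.finrank_eq_zero] at h0
    have h4 : A.mulVecLin (Pi.single 0 1) = 0 := by
      rw [LinearMap.range_eq_bot.1 h0, LinearMap.zero_apply]
    have := congrFun h4 0
    simp at this
    exact (hpos 0).ne' this
  simp only [Module.finrank_fin_fun] at h1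
  change Module.finrank ℤ (LinearMap.ker A.mulVecLin) = 2
  omega

lemma HasCIForm.isCompleteIntersection {K : Type*} [Field K] {A : Matrix (Fin 1) (Fin 3) ℤ}
    (hpos : ∀ j, 0 < A 0 j) {M : Set (Fin 3 → ℤ)} (hM : IsMarkovBasis K A M)
    {ρ : Equiv.Perm (Fin 3)} {b₁ b₂ c₁ c₂ c₃ : ℤ} (h : HasCIForm M ρ b₁ b₂ c₁ c₂ c₃) :
    IsCompleteIntersection K A := by
  obtain ⟨-, -, -, -, -, ε₁, ε₂, hM'⟩ := h
  unfold IsCompleteIntersection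
  rw [finrank_latticeKer hpos, ← hM.2, hM']
  refine ⟨![moveBinomial K (ε₁ • relabel ρ ![b₁, -b₂, 0]),
    moveBinomial K (ε₂ • relabel ρ ![c₁, c₂, -c₃])], ?_⟩
  rw [Set.image_pair]
  congr 1
  ext f
  simp [or_comm]

/-- Restriction of a polynomial to the `i`-th coordinate axis. -/
noncomputable def axisRestriction (K : Type*) [Field K] (i : Fin 3) :
    MvPolynomial (Fin 3) K →ₐ[K] Polynomial K :=
  MvPolynomial.aeval (Pi.single i Polynomial.X)

lemma axisRestriction_monomial (K : Type*) [Field K] (i : Fin 3) {x : Fin 3 →₀ ℕ}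
    (h : ∀ j, j ≠ i → x j = 0) :
    axisRestriction K i (MvPolynomial.monomial x 1) = Polynomial.X ^ x i := by
  rw [axisRestriction, MvPolynomial.aeval_monomial, map_one, one_mul,
    Finsupp.prod_fintype _ _ (by simp), Finset.prod_eq_single i]
  · simp
  · intro j _ hj
    simp [h j hj]
  · simp

lemma axisRestriction_monomial_eq_zero (K : Type*) [Field K] (i : Fin 3) {x : Fin 3 →₀ ℕ}
    {j : Fin 3} (hj : j ≠ i) (h : x j ≠ 0) :
    axisRestriction K i (MvPolynomial.monomial x 1) = 0 := by
  rw [axisRestriction, MvPolynomial.aeval_monomial, map_one, one_mul,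
    Finsupp.prod_fintype _ _ (by simp)]
  exact Finset.prod_eq_zero (Finset.mem_univ j) (by simp [hj, h])

lemma axisRestriction_coeff_zero (K : Type*) [Field K] (i : Fin 3) (f : MvPolynomial (Fin 3) K) :
    (axisRestriction K i f).coeff 0 = MvPolynomial.constantCoeff f := by
  induction f using MvPolynomial.induction_on with
  | C a => simp [axisRestriction]
  | add p q hp hq => simp [hp, hq]
  | mul_X p j _ =>
    rw [map_mul, Polynomial.mul_coeff_zero, axisRestriction, MvPolynomial.aeval_X]
    rcases eq_or_ne j i with rfl | hj <;> simp [*]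

/-- An ideal generated by two polynomials cannot contain pure powers of the three variables, each
minimal for the restriction to its axis, with independent leading vectors. -/
lemma not_generated_by_two {K : Type*} [Field K] {I : Ideal (MvPolynomial (Fin 3) K)}
    {c : Fin 3 → ℕ} (hI : ∀ i, ∀ f ∈ I, Polynomial.X ^ c i ∣ axisRestriction K i f)
    (g : Fin 3 → MvPolynomial (Fin 3) K) (hg : ∀ j, g j ∈ I)
    (hgc : ∀ i j, (axisRestriction K i (g j)).coeff (c i) = if i = j then 1 else 0)
    (f : Fin 2 → MvPolynomial (Fin 3) K) : Ideal.span (Set.range f) ≠ I := by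
  intro hf
  set ψ : MvPolynomial (Fin 3) K → Fin 3 → K := fun p i => (axisRestriction K i p).coeff (c i)
    with hψ
  have hmul : ∀ q, ∀ p ∈ I, ψ (q * p) = MvPolynomial.constantCoeff q • ψ p := by
    intro q p hp
    ext i
    obtain ⟨r, hr⟩ := hI i p hp
    have h1 : ∀ s : Polynomial K, (Polynomial.X ^ c i * s).coeff (c i) = s.coeff 0 := fun s => by
      simpa using Polynomial.coeff_X_pow_mul s (c i) 0
    simp only [hψ, map_mul, hr, Pi.smul_apply, smul_eq_mul]
    rw [mul_left_comm, h1, h1, Polynomial.mul_coeff_zero, axisRestriction_coeff_zero]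
  have hadd : ∀ p q, ψ (p + q) = ψ p + ψ q := by
    intro p q
    ext i
    simp [hψ]
  have hfI : ∀ j, f j ∈ I := fun j => hf ▸ Ideal.subset_span ⟨j, rfl⟩
  have hspan : ∀ p ∈ I, ψ p ∈ Submodule.span K (Set.range (ψ ∘ f)) := by
    intro p hp
    rw [← hf, Ideal.mem_span_range_iff_exists_fun] at hp
    obtain ⟨a, rfl⟩ := hp
    rw [Fin.sum_univ_two, hadd, hmul _ _ (hfI 0), hmul _ _ (hfI 1)]
    exact add_mem (Submodule.smul_mem _ _ (Submodule.subset_span ⟨0, rfl⟩))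
      (Submodule.smul_mem _ _ (Submodule.subset_span ⟨1, rfl⟩))
  have htop : Submodule.span K (Set.range (ψ ∘ f)) = ⊤ := by
    rw [eq_top_iff, ← (Pi.basisFun K (Fin 3)).span_eq, Submodule.span_le]
    rintro _ ⟨j, rfl⟩
    have : Pi.basisFun K (Fin 3) j = ψ (g j) := by
      ext i
      simp [hψ, hgc, Pi.single_apply]
    rw [this]
    exact hspan _ (hg j)
  have := finrank_range_le_card (R := K) (ψ ∘ f)
  rw [Set.finrank, htop, finrank_top] at this
  simp at this

lemma axisRestriction_moveBinomial (K : Type*) [Field K] (i : Fin 3) {u : Fin 3 → ℤ} (hi : u i < 0)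
    {j : Fin 3} (hj : 0 < u j) (hneg : ∀ l, l ≠ i → 0 ≤ u l) :
    axisRestriction K i (moveBinomial K u) = -Polynomial.X ^ (-u i).toNat := by
  have hji : j ≠ i := by rintro rfl; omega
  rw [moveBinomial_eq, map_sub, axisRestriction_monomial_eq_zero K i hji (by simpa using hj),
    axisRestriction_monomial K i (fun l hl => by simpa using hneg l hl)]
  simp

lemma axisRestriction_moveBinomial_eq_zero (K : Type*) [Field K] (i : Fin 3) {u : Fin 3 → ℤ}
    {j k : Fin 3} (hji : j ≠ i) (hj : 0 < u j) (hki : k ≠ i) (hk : u k < 0) :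
    axisRestriction K i (moveBinomial K u) = 0 := by
  rw [moveBinomial_eq, map_sub, axisRestriction_monomial_eq_zero K i hji (by simpa using hj),
    axisRestriction_monomial_eq_zero K i hki (by simpa using hk), sub_zero]

lemma moveBinomial_neg (K : Type*) [Field K] {n : ℕ} (u : Fin n → ℤ) :
    moveBinomial K (-u) = -moveBinomial K u := by
  rw [moveBinomial_eq, moveBinomial_eq, neg_neg, neg_sub]

lemma moveBinomial_units_smul (K : Type*) [Field K] {n : ℕ} (ε : ℤˣ) (u : Fin n → ℤ) :
    moveBinomial K (ε • u) = (((ε : ℤ) : K)) • moveBinomial K u := by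
  rcases Int.units_eq_one_or ε with rfl | rfl
  · simp
  · have : (-1 : ℤˣ) • u = -u := by ext; simp
    rw [this, moveBinomial_neg]
    simp

lemma HasNonCIForm.not_isCompleteIntersection {K : Type*} [Field K]
    {A : Matrix (Fin 1) (Fin 3) ℤ} (hpos : ∀ j, 0 < A 0 j) {M : Set (Fin 3 → ℤ)}
    (hM : IsMarkovBasis K A M) {c₁ c₂ c₃ v₁₂ v₁₃ v₂₁ v₂₃ v₃₁ v₃₂ : ℤ}
    (h : HasNonCIForm M 1 c₁ c₂ c₃ v₁₂ v₁₃ v₂₁ v₂₃ v₃₁ v₃₂) : ¬ IsCompleteIntersection K A := by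
  obtain ⟨h1, h2, h3, h12, h13, h21, h23, h31, h32, ε₁, ε₂, ε₃, hM'⟩ := h
  unfold IsCompleteIntersection
  rw [finrank_latticeKer hpos, ← hM.2, not_exists]
  have hrel : ∀ w, relabel 1 w = w := fun w => rfl
  simp only [hrel] at hM'
  set m : Fin 3 → Fin 3 → ℤ := ![![-c₁, v₁₂, v₁₃], ![v₂₁, -c₂, v₂₃], ![v₃₁, v₃₂, -c₃]] with hm
  set ε : Fin 3 → ℤˣ := ![ε₁, ε₂, ε₃] with hε
  have hMr : M = Set.range fun i => ε i • m i := by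
    rw [hM']
    ext z
    simp [hm, hε, Fin.exists_fin_succ, eq_comm]
  have hdiag : ∀ i, m i i < 0 := by intro i; fin_cases i <;> simp [*]
  have hoff : ∀ i j, i ≠ j → 0 < m i j := by
    intro i j hij
    fin_cases i <;> fin_cases j <;> simp [*] at hij ⊢
  have hres : ∀ i j, axisRestriction K i (moveBinomial K (m j)) =
      if i = j then -Polynomial.X ^ (-m i i).toNat else 0 := by
    intro i j
    split_ifs with hij
    · subst hij
      have hi : i ≠ i + 1 := by decide +revert
      exact axisRestriction_moveBinomial K i (hdiag i) (hoff i _ hi)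
        fun l hl => (hoff i l hl.symm).le
    · obtain ⟨k, hki, hkj, -⟩ := exists_third hij
      exact axisRestriction_moveBinomial_eq_zero K i hki (hoff j k hkj.symm) (Ne.symm hij)
        (hdiag j)
  have hmem : ∀ j, moveBinomial K (m j) ∈ Ideal.span (moveBinomial K '' M) := by
    intro j
    have h4 : moveBinomial K (ε j • m j) ∈ Ideal.span (moveBinomial K '' M) :=
      Ideal.subset_span ⟨_, hMr ▸ ⟨j, rfl⟩, rfl⟩
    rw [moveBinomial_units_smul] at h4
    rcases Int.units_eq_one_or (ε j) with h5 | h5 <;> rw [h5] at h4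
    · simpa using h4
    · simpa using h4
  refine not_generated_by_two (c := fun i => (-m i i).toNat) ?_ (fun j => -moveBinomial K (m j))
    (fun j => neg_mem (hmem j)) ?_
  · intro i f hf
    rw [← Ideal.mem_span_singleton, ← Ideal.mem_comap]
    refine Ideal.span_le.2 ?_ hf
    rintro _ ⟨u, hu, rfl⟩
    rw [hMr] at hu
    obtain ⟨j, rfl⟩ := hu
    rw [SetLike.mem_coe, Ideal.mem_comap, Ideal.mem_span_singleton]
    dsimp only
    rw [moveBinomial_units_smul, map_smul, hres]
    rw [Polynomial.smul_eq_C_mul]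
    refine Dvd.dvd.mul_left ?_ _
    split_ifs <;> simp
  · intro i j
    rw [map_neg, hres]
    split_ifs <;> simp

/-- The move `-u` is applicable to `z⁺` and shortens `z`. -/
def Shortens {n : ℕ} (u z : Fin n → ℤ) : Prop :=
  u⁺ ≤ z⁺ ∧ ∑ i, |z i - u i| < ∑ i, |z i|

lemma moveReduces_iff {n : ℕ} {u z : Fin n → ℤ} : MoveReduces u z ↔
    Shortens (-u) z ∨ Shortens u z ∨ Shortens (-u) (-z) ∨ Shortens u (-z) := by
  have hz : ∀ i, z⁺ i - z⁻ i = z i := fun i => congrFun (posPart_sub_negPart z) i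
  have h0 : l1dist z⁺ z⁻ = ∑ i, |z i| := by simp only [l1dist, hz]
  have h0' : ∑ i, |(-z) i| = ∑ i, |z i| := by simp
  have h1 : l1dist (z⁺ + u) z⁻ = ∑ i, |z i - (-u) i| := by
    simp only [l1dist, ← hz, Pi.add_apply, Pi.neg_apply]
    exact Finset.sum_congr rfl fun i _ => by ring_nf
  have h2 : l1dist (z⁺ - u) z⁻ = ∑ i, |z i - u i| := by
    simp only [l1dist, ← hz, Pi.sub_apply]
    exact Finset.sum_congr rfl fun i _ => by ring_nf
  have h3 : l1dist z⁺ (z⁻ + u) = ∑ i, |(-z) i - (-u) i| := by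
    simp only [l1dist, Pi.neg_apply, ← hz, Pi.add_apply]
    exact Finset.sum_congr rfl fun i _ => by rw [← abs_neg]; ring_nf
  have h4 : l1dist z⁺ (z⁻ - u) = ∑ i, |(-z) i - u i| := by
    simp only [l1dist, Pi.neg_apply, ← hz, Pi.sub_apply]
    exact Finset.sum_congr rfl fun i _ => by rw [← abs_neg]; ring_nf
  simp only [MoveReduces, Shortens, h0, h1, h2, h3, h4, h0', posPart_neg]

lemma moveReduces_neg_left {n : ℕ} {u z : Fin n → ℤ} : MoveReduces (-u) z ↔ MoveReduces u z := by
  rw [moveReduces_iff, moveReduces_iff, neg_neg]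
  constructor <;> rintro (h | h | h | h) <;> simp [h]

lemma moveReduces_neg_right {n : ℕ} {u z : Fin n → ℤ} :
    MoveReduces u (-z) ↔ MoveReduces u z := by
  rw [moveReduces_iff, moveReduces_iff, neg_neg]
  constructor <;> rintro (h | h | h | h) <;> simp [h]

lemma moveReduces_units_smul {n : ℕ} (ε : ℤˣ) {u z : Fin n → ℤ} :
    MoveReduces (ε • u) z ↔ MoveReduces u z := by
  rcases Int.units_eq_one_or ε with rfl | rfl
  · simp
  · have : (-1 : ℤˣ) • u = -u := by ext; simp
    rw [this, moveReduces_neg_left]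

lemma moveReduces_relabel (ρ : Equiv.Perm (Fin 3)) {u z : Fin 3 → ℤ} :
    MoveReduces (relabel ρ u) (relabel ρ z) ↔ MoveReduces u z := by
  have hle : ∀ x y : Fin 3 → ℤ, relabel ρ x ≤ relabel ρ y ↔ x ≤ y := fun x y => by
    refine ⟨fun h s => ?_, fun h t => h _⟩
    simpa [relabel_apply] using h (ρ s)
  have hd : ∀ x y : Fin 3 → ℤ, l1dist (relabel ρ x) (relabel ρ y) = l1dist x y := fun x y =>
    Equiv.sum_comp ρ.symm fun s => |x s - y s|
  have hp : ∀ x : Fin 3 → ℤ, (relabel ρ x)⁺ = relabel ρ x⁺ := fun x => rfl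
  have hn : ∀ x : Fin 3 → ℤ, (relabel ρ x)⁻ = relabel ρ x⁻ := fun x => rfl
  have ha : ∀ x y : Fin 3 → ℤ, relabel ρ x + relabel ρ y = relabel ρ (x + y) := fun x y => rfl
  have hs : ∀ x y : Fin 3 → ℤ, relabel ρ x - relabel ρ y = relabel ρ (x - y) := fun x y => rfl
  simp only [MoveReduces, hp, hn, ha, hs, hle, hd]

lemma shortens_iff {a b c x y z : ℤ} : Shortens ![a, b, c] ![x, y, z] ↔
    (max a 0 ≤ max x 0 ∧ max b 0 ≤ max y 0 ∧ max c 0 ≤ max z 0) ∧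
      |x - a| + |y - b| + |z - c| < |x| + |y| + |z| := by
  simp only [Shortens, Pi.le_def, Fin.forall_fin_succ, Fin.sum_univ_three]
  simp [Pi.posPart_apply, posPart_def]

lemma neg_vec3 (a b c : ℤ) : -![a, b, c] = ![-a, -b, -c] := by simp

/-- Coordinate form of `MoveReduces` for three coordinates. -/
lemma moveReduces_vec_iff {a b c x y z : ℤ} : MoveReduces ![a, b, c] ![x, y, z] ↔
    Shortens ![-a, -b, -c] ![x, y, z] ∨ Shortens ![a, b, c] ![x, y, z] ∨
    Shortens ![-a, -b, -c] ![-x, -y, -z] ∨ Shortens ![a, b, c] ![-x, -y, -z] := by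
  rw [moveReduces_iff, neg_vec3, neg_vec3]

lemma ci_reduces {b₁ b₂ c₁ c₂ c₃ : ℤ} (hb₂ : 0 < b₂) (hb : b₂ < b₁) (hc₁ : 0 ≤ c₁) (hc₂ : 0 ≤ c₂)
    (hc₃ : 0 < c₃) (hc : c₁ < c₂ + c₃) {β γ : ℤ} (hγ : 0 ≤ γ) (hβ : γ = 0 → 0 < β) :
    MoveReduces ![b₁, -b₂, 0] ![γ * c₁ + β * b₁, γ * c₂ - β * b₂, -(γ * c₃)] ∨
    MoveReduces ![c₁, c₂, -c₃] ![γ * c₁ + β * b₁, γ * c₂ - β * b₂, -(γ * c₃)] := by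
  rw [moveReduces_vec_iff, moveReduces_vec_iff]
  rcases lt_trichotomy β 0 with h | h | h
  · right; right; right; left
    have hγ1 : 1 ≤ γ := by by_contra h'; have := hβ (by omega); omega
    have h1 : c₂ ≤ γ * c₂ - β * b₂ := by nlinarith
    have h2 : c₃ ≤ γ * c₃ := by nlinarith
    rw [shortens_iff]
    generalize γ * c₁ + β * b₁ = x at *
    generalize γ * c₂ - β * b₂ = y at *
    generalize γ * c₃ = w at *
    simp only [abs_eq_max_neg]
    omega
  · right; right; left
    subst h
    have hγ1 : 1 ≤ γ := by by_contra h'; have := hβ (by omega); omega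
    have h1 : c₁ ≤ γ * c₁ := by nlinarith
    have h2 : c₂ ≤ γ * c₂ := by nlinarith
    have h3 : c₃ ≤ γ * c₃ := by nlinarith
    rw [shortens_iff]
    simp only [abs_eq_max_neg]
    omega
  · left; right; left
    have h1 : b₁ ≤ γ * c₁ + β * b₁ := by nlinarith [mul_nonneg hγ hc₁]
    rw [shortens_iff]
    generalize γ * c₁ + β * b₁ = x at *
    generalize γ * c₂ - β * b₂ = y at *
    generalize γ * c₃ = w at *
    simp only [abs_eq_max_neg]
    omega

lemma ci_lt_of_reduces {b₁ b₂ c₁ c₂ c₃ p q : ℤ} (hb₂ : 0 < b₂) (hb : b₂ < b₁) (hc₂ : 0 ≤ c₂)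
    (hc₃ : 0 < c₃) (hp : 0 < p) (hq : 0 < q)
    (h : MoveReduces ![b₁, -b₂, 0] ![0, p, -q] ∨ MoveReduces ![c₁, c₂, -c₃] ![0, p, -q]) :
    c₁ < c₂ + c₃ := by
  by_contra hlt
  rw [moveReduces_vec_iff, moveReduces_vec_iff] at h
  simp only [shortens_iff] at h
  rcases h with (⟨h, h'⟩ | ⟨h, h'⟩ | ⟨h, h'⟩ | ⟨h, h'⟩) | (⟨h, h'⟩ | ⟨h, h'⟩ | ⟨h, h'⟩ | ⟨h, h'⟩)
  all_goals
    simp only [abs_eq_max_neg] at h'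
    omega

lemma nonCI_lt_of_reduces {c₁ c₂ c₃ v₁₂ v₁₃ v₂₁ v₂₃ v₃₁ v₃₂ p q : ℤ} (h1 : 0 < c₁) (h2 : 0 < c₂)
    (h3 : 0 < c₃) (h12 : 0 < v₁₂) (h13 : 0 < v₁₃) (h21 : 0 < v₂₁) (h23 : 0 < v₂₃) (h31 : 0 < v₃₁)
    (h32 : 0 < v₃₂) (hp : 0 < p) (hq : 0 < q)
    (h : MoveReduces ![-c₁, v₁₂, v₁₃] ![0, p, -q] ∨ MoveReduces ![v₂₁, -c₂, v₂₃] ![0, p, -q] ∨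
      MoveReduces ![v₃₁, v₃₂, -c₃] ![0, p, -q]) : v₂₁ < c₂ + v₂₃ ∨ v₃₁ < v₃₂ + c₃ := by
  by_contra hlt
  push Not at hlt
  rw [moveReduces_vec_iff, moveReduces_vec_iff, moveReduces_vec_iff] at h
  simp only [shortens_iff] at h
  rcases h with (⟨h, h'⟩ | ⟨h, h'⟩ | ⟨h, h'⟩ | ⟨h, h'⟩) | (⟨h, h'⟩ | ⟨h, h'⟩ | ⟨h, h'⟩ | ⟨h, h'⟩) |
    (⟨h, h'⟩ | ⟨h, h'⟩ | ⟨h, h'⟩ | ⟨h, h'⟩)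
  all_goals
    simp only [abs_eq_max_neg] at h'
    omega

lemma nonCI_reduces_of_two {c₁ c₂ c₃ v₁₂ v₁₃ v₂₁ v₂₃ v₃₁ v₃₂ : ℤ} (h12 : 0 < v₁₂)
    (h13 : 0 < v₁₃) (h21 : 0 < v₂₁) (h23 : 0 < v₂₃) (h31 : 0 < v₃₁) (h32 : 0 < v₃₂)
    (e1 : c₁ = v₂₁ + v₃₁) (e2 : c₂ = v₁₂ + v₃₂) (e3 : c₃ = v₁₃ + v₂₃) (hc : v₁₂ + v₁₃ < c₁)
    (hv : v₂₁ < c₂ + v₂₃ ∨ v₃₁ < v₃₂ + c₃) {α γ : ℤ} (hα : 0 ≤ α) (hγ : 0 ≤ γ)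
    (hne : α = 0 → γ ≠ 0) :
    MoveReduces ![-c₁, v₁₂, v₁₃] ![-(α * c₁) + γ * v₃₁, α * v₁₂ + γ * v₃₂, α * v₁₃ - γ * c₃] ∨
    MoveReduces ![v₂₁, -c₂, v₂₃] ![-(α * c₁) + γ * v₃₁, α * v₁₂ + γ * v₃₂, α * v₁₃ - γ * c₃] ∨
    MoveReduces ![v₃₁, v₃₂, -c₃] ![-(α * c₁) + γ * v₃₁, α * v₁₂ + γ * v₃₂, α * v₁₃ - γ * c₃] := by
  simp only [moveReduces_vec_iff]
  rcases hα.eq_or_lt with rfl | hα'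
  · right; right; right; left
    have hγ1 : 1 ≤ γ := by have := hne rfl; omega
    have k1 : v₃₁ ≤ γ * v₃₁ := by nlinarith
    have k2 : v₃₂ ≤ γ * v₃₂ := by nlinarith
    have k3 : c₃ ≤ γ * c₃ := by nlinarith
    rw [shortens_iff]
    simp only [abs_eq_max_neg]
    omega
  rcases lt_trichotomy γ α with h | h | h
  · left; right; right; left
    have k1 : -(α * c₁) + γ * v₃₁ ≤ -c₁ := by nlinarith
    rw [shortens_iff]
    generalize -(α * c₁) + γ * v₃₁ = x at *
    generalize α * v₁₂ + γ * v₃₂ = y at *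
    generalize α * v₁₃ - γ * c₃ = w at *
    simp only [abs_eq_max_neg]
    omega
  · right; left; left
    subst h
    have k1 : -(γ * c₁) + γ * v₃₁ ≤ -v₂₁ := by nlinarith
    have k2 : c₂ ≤ γ * v₁₂ + γ * v₃₂ := by nlinarith
    have k3 : γ * v₁₃ - γ * c₃ ≤ -v₂₃ := by nlinarith
    rw [shortens_iff]
    generalize -(γ * c₁) + γ * v₃₁ = x at *
    generalize γ * v₁₂ + γ * v₃₂ = y at *
    generalize γ * v₁₃ - γ * c₃ = w at *
    simp only [abs_eq_max_neg]
    omega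
  · have k2 : c₂ ≤ α * v₁₂ + γ * v₃₂ := by nlinarith
    have k3 : α * v₁₃ - γ * c₃ ≤ -c₃ := by nlinarith
    rcases hv with hv | hv
    · right; left; left
      rw [shortens_iff]
      generalize -(α * c₁) + γ * v₃₁ = x at *
      generalize α * v₁₂ + γ * v₃₂ = y at *
      generalize α * v₁₃ - γ * c₃ = w at *
      simp only [abs_eq_max_neg]
      omega
    · right; right; right; right; left
      rw [shortens_iff]
      generalize -(α * c₁) + γ * v₃₁ = x at *
      generalize α * v₁₂ + γ * v₃₂ = y at *
      generalize α * v₁₃ - γ * c₃ = w at *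
      simp only [abs_eq_max_neg]
      omega

lemma nonCI_reduces {c₁ c₂ c₃ v₁₂ v₁₃ v₂₁ v₂₃ v₃₁ v₃₂ : ℤ} (h12 : 0 < v₁₂)
    (h13 : 0 < v₁₃) (h21 : 0 < v₂₁) (h23 : 0 < v₂₃) (h31 : 0 < v₃₁) (h32 : 0 < v₃₂)
    (e1 : c₁ = v₂₁ + v₃₁) (e2 : c₂ = v₁₂ + v₃₂) (e3 : c₃ = v₁₃ + v₂₃) (hc : v₁₂ + v₁₃ < c₁)
    (hv : v₂₁ < c₂ + v₂₃ ∨ v₃₁ < v₃₂ + c₃) {α β γ : ℤ} (hne : ¬ (α = β ∧ β = γ)) :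
    let z := ![-(α * c₁) + β * v₂₁ + γ * v₃₁, α * v₁₂ - β * c₂ + γ * v₃₂,
      α * v₁₃ + β * v₂₃ - γ * c₃]
    MoveReduces ![-c₁, v₁₂, v₁₃] z ∨ MoveReduces ![v₂₁, -c₂, v₂₃] z ∨
      MoveReduces ![v₃₁, v₃₂, -c₃] z := by
  intro z
  by_cases hβ : β ≤ α ∧ β ≤ γ
  · have hz : z = ![-((α - β) * c₁) + (γ - β) * v₃₁, (α - β) * v₁₂ + (γ - β) * v₃₂,
        (α - β) * v₁₃ - (γ - β) * c₃] := by
      refine Matrix.vec3_eq ?_ ?_ ?_ <;> simp only [e1, e2, e3] <;> ring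
    rw [hz]
    exact nonCI_reduces_of_two h12 h13 h21 h23 h31 h32 e1 e2 e3 hc hv (by omega) (by omega)
      (by omega)
  by_cases hγ : γ ≤ α ∧ γ ≤ β
  · have hz : z = relabel (Equiv.swap 1 2) ![-((α - γ) * c₁) + (β - γ) * v₂₁,
        (α - γ) * v₁₃ + (β - γ) * v₂₃, (α - γ) * v₁₂ - (β - γ) * c₂] := by
      rw [eq_relabel_iff]
      intro s
      fin_cases s <;> simp [z, e1, e2, e3, Equiv.swap_apply_of_ne_of_ne] <;> lia
    have hs : ∀ a b c : ℤ, ![a, b, c] = relabel (Equiv.swap 1 2) ![a, c, b] := by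
      intro a b c
      rw [eq_relabel_iff]
      intro s
      fin_cases s <;> simp [Equiv.swap_apply_of_ne_of_ne]
    rw [hz, hs (-c₁), hs v₂₁, hs v₃₁, moveReduces_relabel, moveReduces_relabel,
      moveReduces_relabel, or_comm (a := MoveReduces ![v₂₁, v₂₃, -c₂] _)]
    exact nonCI_reduces_of_two h13 h12 h31 h32 h21 h23 (by omega) (by omega) (by omega)
      (by omega) (by omega) (by omega) (by omega) (by omega)
  · have hβ' : 1 ≤ β - α := by omega
    have hγ' : 1 ≤ γ - α := by omega
    have hz : z = ![(β - α) * v₂₁ + (γ - α) * v₃₁, -((β - α) * c₂) + (γ - α) * v₃₂,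
        (β - α) * v₂₃ - (γ - α) * c₃] := by
      refine Matrix.vec3_eq ?_ ?_ ?_ <;> simp only [e1, e2, e3] <;> ring
    rw [hz]
    left
    rw [moveReduces_vec_iff]
    left
    have k1 : c₁ ≤ (β - α) * v₂₁ + (γ - α) * v₃₁ := by nlinarith
    rw [shortens_iff]
    generalize (β - α) * v₂₁ + (γ - α) * v₃₁ = x at *
    generalize -((β - α) * c₂) + (γ - α) * v₃₂ = y at *
    generalize (β - α) * v₂₃ - (γ - α) * c₃ = w at *
    simp only [abs_eq_max_neg]
    omega

lemma mem_latticeKer_relabel {A : Matrix (Fin 1) (Fin 3) ℤ} {ρ : Equiv.Perm (Fin 3)} {x y z : ℤ} :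
    relabel ρ ![x, y, z] ∈ latticeKer A ↔
      A 0 (ρ 0) * x + A 0 (ρ 1) * y + A 0 (ρ 2) * z = 0 := by
  rw [mem_latticeKer_iff, ← Equiv.sum_comp ρ]
  simp [relabel_apply, Fin.sum_univ_three]

lemma lastCircuit_eq {A : Matrix (Fin 1) (Fin 3) ℤ} (hpos : ∀ j, 0 < A 0 j)
    (ρ : Equiv.Perm (Fin 3)) : ∃ p q : ℤ, 0 < p ∧ 0 < q ∧
      lastCircuit A ρ = relabel ρ ![0, p, -q] ∧ lastCircuit A ρ ∈ circuits A := by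
  set g : ℤ := (Int.gcd (A 0 (ρ 1)) (A 0 (ρ 2)) : ℤ) with hg
  have h1 := hpos (ρ 1)
  have h2 := hpos (ρ 2)
  have hg0 : 0 < g := by
    rw [hg]
    exact_mod_cast Int.gcd_pos_of_ne_zero_left _ h1.ne'
  have d1 : g ∣ A 0 (ρ 1) := Int.gcd_dvd_left _ _
  have d2 : g ∣ A 0 (ρ 2) := Int.gcd_dvd_right _ _
  have hp := Int.ediv_pos_of_pos_of_dvd h2 hg0.le d2
  have hq := Int.ediv_pos_of_pos_of_dvd h1 hg0.le d1
  refine ⟨A 0 (ρ 2) / g, A 0 (ρ 1) / g, hp, hq, rfl, ?_, ?_⟩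
  · rw [lastCircuit, mem_latticeKer_relabel, ← hg]
    have := Int.mul_ediv_assoc (A 0 (ρ 1)) d2
    have h3 := Int.mul_ediv_assoc (A 0 (ρ 2)) d1
    rw [mul_comm (A 0 (ρ 2))] at h3
    linarith
  · have : Function.support (lastCircuit A ρ) = {ρ 1, ρ 2} := by
      ext t
      obtain ⟨s, rfl⟩ := ρ.surjective t
      rw [Function.mem_support, lastCircuit, relabel_apply, ← hg]
      have hp' := hp.ne'
      have hq' := hq.ne'
      fin_cases s <;> simp_all
    rw [this, Set.ncard_pair (ρ.injective.ne (by decide))]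

section Forms

variable {K : Type*} [Field K] {A : Matrix (Fin 1) (Fin 3) ℤ} {M : Set (Fin 3 → ℤ)}
  {ρ : Equiv.Perm (Fin 3)}

lemma units_zsmul_eq (ε : ℤˣ) (w : Fin 3 → ℤ) : ε • w = (ε : ℤ) • w := rfl

lemma HasCIForm.isDistanceReducing (hM : IsMarkovBasis K A M) {b₁ b₂ c₁ c₂ c₃ : ℤ}
    (h : HasCIForm M ρ b₁ b₂ c₁ c₂ c₃) (hc : c₁ < c₂ + c₃) : IsDistanceReducing A M := by
  obtain ⟨hb₂, hb, hc₁, hc₂, hc₃, ε₁, ε₂, hM'⟩ := h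
  suffices key : ∀ γ β : ℤ, 0 ≤ γ → (γ = 0 → 0 < β) → ∀ z, (z =
      relabel ρ ![γ * c₁ + β * b₁, γ * c₂ - β * b₂, -(γ * c₃)] ∨ -z =
      relabel ρ ![γ * c₁ + β * b₁, γ * c₂ - β * b₂, -(γ * c₃)]) → ∃ u ∈ M, MoveReduces u z by
    intro z hz hz0
    have hmem := hM.mem_span hz
    rw [hM', Submodule.mem_span_pair] at hmem
    obtain ⟨β, γ, rfl⟩ := hmem
    set β' := β * ε₁ with hβ'
    set γ' := γ * ε₂ with hγ'
    have hform : β • ε₁ • relabel ρ ![b₁, -b₂, 0] + γ • ε₂ • relabel ρ ![c₁, c₂, -c₃] =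
        relabel ρ ![γ' * c₁ + β' * b₁, γ' * c₂ - β' * b₂, -(γ' * c₃)] := by
      rw [eq_relabel_iff]
      intro s
      simp only [units_zsmul_eq, Pi.add_apply, Pi.smul_apply, relabel_apply]
      fin_cases s <;> simp [hβ', hγ'] <;> ring
    have hneg : -relabel ρ ![γ' * c₁ + β' * b₁, γ' * c₂ - β' * b₂, -(γ' * c₃)] =
        relabel ρ ![-γ' * c₁ + -β' * b₁, -γ' * c₂ - -β' * b₂, -(-γ' * c₃)] := by
      rw [eq_relabel_iff]
      intro s
      simp only [Pi.neg_apply, relabel_apply]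
      fin_cases s <;> simp <;> ring
    rw [hform] at hz0 ⊢
    by_cases h0 : 0 ≤ γ' ∧ (γ' = 0 → 0 < β')
    · exact key γ' β' h0.1 h0.2 _ (.inl rfl)
    · refine key (-γ') (-β') (by omega) (fun h1 => ?_) _ (.inr hneg)
      by_contra h2
      refine hz0 ?_
      have h3 : γ' = 0 := by omega
      have h4 : β' = 0 := by omega
      rw [h3, h4]
      ext t
      simp [relabel]
      generalize ρ.symm t = s
      fin_cases s <;> rfl
  intro γ β hγ hβ z hz
  have h1 : MoveReduces (relabel ρ ![b₁, -b₂, 0]) z ∨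
      MoveReduces (relabel ρ ![c₁, c₂, -c₃]) z := by
    have h2 := ci_reduces hb₂ hb hc₁ hc₂ hc₃ hc hγ hβ
    rw [← moveReduces_relabel ρ, ← moveReduces_relabel ρ (u := ![c₁, c₂, -c₃])] at h2
    rcases hz with hz | hz
    · rwa [← hz] at h2
    · rwa [← hz, moveReduces_neg_right, moveReduces_neg_right] at h2
  rw [hM']
  rcases h1 with h1 | h1
  · exact ⟨_, .inl rfl, (moveReduces_units_smul _).2 h1⟩
  · exact ⟨_, .inr rfl, (moveReduces_units_smul _).2 h1⟩

lemma HasCIForm.lt_of_reducesDistance (hpos : ∀ j, 0 < A 0 j) {b₁ b₂ c₁ c₂ c₃ : ℤ}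
    (h : HasCIForm M ρ b₁ b₂ c₁ c₂ c₃) (hr : ReducesDistance M {lastCircuit A ρ}) :
    c₁ < c₂ + c₃ := by
  obtain ⟨hb₂, hb, hc₁, hc₂, hc₃, ε₁, ε₂, hM'⟩ := h
  obtain ⟨p, q, hp, hq, hz, -⟩ := lastCircuit_eq hpos ρ
  obtain ⟨u, hu, hred⟩ := hr _ rfl fun h0 => by
    have := congrFun h0 (ρ 1)
    rw [hz, relabel_apply] at this
    exact hp.ne' this
  rw [hz] at hred
  refine ci_lt_of_reduces (c₁ := c₁) hb₂ hb hc₂ hc₃ hp hq ?_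
  rw [hM'] at hu
  rcases hu with rfl | rfl <;> rw [moveReduces_units_smul, moveReduces_relabel] at hred
  exacts [.inl hred, .inr hred]

lemma HasNonCIForm.lt_of_reducesDistance (hpos : ∀ j, 0 < A 0 j)
    {c₁ c₂ c₃ v₁₂ v₁₃ v₂₁ v₂₃ v₃₁ v₃₂ : ℤ}
    (h : HasNonCIForm M ρ c₁ c₂ c₃ v₁₂ v₁₃ v₂₁ v₂₃ v₃₁ v₃₂)
    (hr : ReducesDistance M {lastCircuit A ρ}) : v₂₁ < c₂ + v₂₃ ∨ v₃₁ < v₃₂ + c₃ := by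
  obtain ⟨h1, h2, h3, h12, h13, h21, h23, h31, h32, ε₁, ε₂, ε₃, hM'⟩ := h
  obtain ⟨p, q, hp, hq, hz, -⟩ := lastCircuit_eq hpos ρ
  obtain ⟨u, hu, hred⟩ := hr _ rfl fun h0 => by
    have := congrFun h0 (ρ 1)
    rw [hz, relabel_apply] at this
    exact hp.ne' this
  rw [hz] at hred
  refine nonCI_lt_of_reduces h1 h2 h3 h12 h13 h21 h23 h31 h32 hp hq ?_
  rw [hM'] at hu
  rcases hu with rfl | rfl | rfl <;> rw [moveReduces_units_smul, moveReduces_relabel] at hred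
  exacts [.inl hred, .inr (.inl hred), .inr (.inr hred)]

/-- If each move has exactly one negative entry, on the diagonal, then these entries are
bounds for the kernel vectors with exactly one positive entry. -/
lemma IsMarkovBasis.le_of_mem_latticeKer (hM : IsMarkovBasis K A M) {m : Fin 3 → Fin 3 → ℤ}
    {ε : Fin 3 → ℤˣ} (hM' : M = Set.range fun s => ε s • relabel ρ (m s))
    (hdiag : ∀ s, m s s < 0) (hoff : ∀ s t, s ≠ t → 0 < m s t) {z : Fin 3 → ℤ}
    (hz : z ∈ latticeKer A) {s : Fin 3} (hs : 0 < z (ρ s)) (hneg : ∀ t, t ≠ s → z (ρ t) ≤ 0) :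
    -m s s ≤ z (ρ s) := by
  obtain heq | ⟨⟨u, hu, hle⟩, -⟩ := (hM.moveConn (weight_natPos hz)).exists_le
  · have := DFunLike.congr_fun heq (ρ s)
    simp only [natPos_apply, Pi.neg_apply] at this
    omega
  rw [hM'] at hu
  obtain ⟨r, rfl⟩ := hu
  have hor : natPos (relabel ρ (m r)) ≤ natPos z ∨ natPos (-relabel ρ (m r)) ≤ natPos z := by
    rcases Int.units_eq_one_or (ε r) with h | h
    · simpa [h] using hle
    · have : (-1 : ℤˣ) • relabel ρ (m r) = -relabel ρ (m r) := by ext; simp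
      simpa [h, this, or_comm] using hle
  rcases hor with h | h
  · obtain ⟨t, hts, htr⟩ : ∃ t, t ≠ s ∧ t ≠ r := by
      clear * -
      decide +revert
    have h1 := h (ρ t)
    simp only [natPos_apply, relabel_apply] at h1
    have h2 := hneg t hts
    have h3 := hoff r t htr.symm
    omega
  · have h1 := h (ρ r)
    simp only [natPos_apply, Pi.neg_apply, relabel_apply] at h1
    rcases eq_or_ne r s with rfl | hrs
    · omega
    · have h2 := hneg r hrs
      have h3 := hdiag r
      omega

end Forms

/-- In a row with three moves of full support, the third critical multiplicity is at most the sum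
of the corresponding entries of the other two moves. -/
lemma critical_le_add {a b c c₁ c₂ c₃ v₁₂ v₁₃ v₂₁ v₂₃ : ℤ} (ha : 0 < a) (hb : 0 < b) (hc : 0 < c)
    (h12 : 0 < v₁₂) (h13 : 0 < v₁₃) (h21 : 0 < v₂₁) (h23 : 0 < v₂₃)
    (e1 : a * c₁ = b * v₁₂ + c * v₁₃) (e2 : b * c₂ = a * v₂₁ + c * v₂₃)
    (P1 : ∀ x y z, a * x + b * y + c * z = 0 → 0 < x → y ≤ 0 → z ≤ 0 → c₁ ≤ x)
    (P2 : ∀ x y z, a * x + b * y + c * z = 0 → x ≤ 0 → 0 < y → z ≤ 0 → c₂ ≤ y)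
    (P3 : ∀ x y z, a * x + b * y + c * z = 0 → x ≤ 0 → y ≤ 0 → 0 < z → c₃ ≤ z) :
    c₃ ≤ v₁₃ + v₂₃ := by
  have e : a * (v₂₁ - c₁) + b * (v₁₂ - c₂) + c * (v₁₃ + v₂₃) = 0 := by linarith
  have e' : a * (c₁ - v₂₁) + b * (c₂ - v₁₂) + c * (-(v₁₃ + v₂₃)) = 0 := by linarith
  have hcv : 0 < c * (v₁₃ + v₂₃) := by positivity
  have h1 : v₂₁ < c₁ := by
    by_contra! h
    have : 0 < c₂ - v₁₂ := by
      by_contra! h'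
      nlinarith [mul_nonneg ha.le (sub_nonneg.2 h), mul_nonneg hb.le (sub_nonneg.2 h')]
    linarith [P2 _ _ _ e' (by linarith) this (by linarith)]
  have h2 : v₁₂ < c₂ := by
    by_contra! h
    linarith [P1 _ _ _ e' (by linarith) (by linarith) (by linarith)]
  exact P3 _ _ _ e (by linarith) (by linarith) (by linarith)

lemma critical_eq_add {a b c c₁ c₂ c₃ v₁₂ v₁₃ v₂₁ v₂₃ v₃₁ v₃₂ : ℤ} (ha : 0 < a) (hb : 0 < b)
    (hc : 0 < c) (h12 : 0 < v₁₂) (h13 : 0 < v₁₃) (h21 : 0 < v₂₁) (h23 : 0 < v₂₃) (h31 : 0 < v₃₁)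
    (h32 : 0 < v₃₂)
    (e1 : a * c₁ = b * v₁₂ + c * v₁₃) (e2 : b * c₂ = a * v₂₁ + c * v₂₃)
    (e3 : c * c₃ = a * v₃₁ + b * v₃₂)
    (P1 : ∀ x y z, a * x + b * y + c * z = 0 → 0 < x → y ≤ 0 → z ≤ 0 → c₁ ≤ x)
    (P2 : ∀ x y z, a * x + b * y + c * z = 0 → x ≤ 0 → 0 < y → z ≤ 0 → c₂ ≤ y)
    (P3 : ∀ x y z, a * x + b * y + c * z = 0 → x ≤ 0 → y ≤ 0 → 0 < z → c₃ ≤ z) :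
    c₁ = v₂₁ + v₃₁ ∧ c₂ = v₁₂ + v₃₂ ∧ c₃ = v₁₃ + v₂₃ := by
  have l3 := critical_le_add ha hb hc h12 h13 h21 h23 e1 e2 P1 P2 P3
  have l2 := critical_le_add (c₃ := c₂) ha hc hb h13 h12 h31 h32 (by linarith) (by linarith)
    (fun x y z h h1 h2 h3 => P1 x z y (by linarith) h1 h3 h2)
    (fun x y z h h1 h2 h3 => P3 x z y (by linarith) h1 h3 h2)
    (fun x y z h h1 h2 h3 => P2 x z y (by linarith) h1 h3 h2)
  have l1 := critical_le_add (c₃ := c₁) hb hc ha h23 h21 h32 h31 (by linarith) (by linarith)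
    (fun x y z h h1 h2 h3 => P2 z x y (by linarith) h3 h1 h2)
    (fun x y z h h1 h2 h3 => P3 z x y (by linarith) h3 h1 h2)
    (fun x y z h h1 h2 h3 => P1 z x y (by linarith) h3 h1 h2)
  have k1 := mul_nonneg ha.le (sub_nonneg.2 l1)
  have k2 := mul_nonneg hb.le (sub_nonneg.2 l2)
  have k3 := mul_nonneg hc.le (sub_nonneg.2 l3)
  have z1 : a * (v₂₁ + v₃₁ - c₁) = 0 := by linarith
  have z2 : b * (v₁₂ + v₃₂ - c₂) = 0 := by linarith
  have z3 : c * (v₁₃ + v₂₃ - c₃) = 0 := by linarith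
  have z1' := (mul_eq_zero.1 z1).resolve_left ha.ne'
  have z2' := (mul_eq_zero.1 z2).resolve_left hb.ne'
  have z3' := (mul_eq_zero.1 z3).resolve_left hc.ne'
  exact ⟨by linarith, by linarith, by linarith⟩

/-- The relations between the entries of the three moves, and the first move as a relation
between the entries of `A`. -/
lemma HasNonCIForm.relations {K : Type*} [Field K] {A : Matrix (Fin 1) (Fin 3) ℤ}
    (hpos : ∀ j, 0 < A 0 j) {M : Set (Fin 3 → ℤ)} (hM : IsMarkovBasis K A M)
    {ρ : Equiv.Perm (Fin 3)} {c₁ c₂ c₃ v₁₂ v₁₃ v₂₁ v₂₃ v₃₁ v₃₂ : ℤ}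
    (h : HasNonCIForm M ρ c₁ c₂ c₃ v₁₂ v₁₃ v₂₁ v₂₃ v₃₁ v₃₂) :
    (c₁ = v₂₁ + v₃₁ ∧ c₂ = v₁₂ + v₃₂ ∧ c₃ = v₁₃ + v₂₃) ∧
      A 0 (ρ 0) * -c₁ + A 0 (ρ 1) * v₁₂ + A 0 (ρ 2) * v₁₃ = 0 := by
  obtain ⟨h1, h2, h3, h12, h13, h21, h23, h31, h32, ε₁, ε₂, ε₃, hM'⟩ := h
  have mem1 : relabel ρ ![-c₁, v₁₂, v₁₃] ∈ latticeKer A := by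
    have : ε₁ • relabel ρ ![-c₁, v₁₂, v₁₃] ∈ latticeKer A := hM.1 (by rw [hM']; simp)
    rcases Int.units_eq_one_or ε₁ with rfl | rfl <;> simpa using this
  have mem2 : relabel ρ ![v₂₁, -c₂, v₂₃] ∈ latticeKer A := by
    have : ε₂ • relabel ρ ![v₂₁, -c₂, v₂₃] ∈ latticeKer A := hM.1 (by rw [hM']; simp)
    rcases Int.units_eq_one_or ε₂ with rfl | rfl <;> simpa using this
  have mem3 : relabel ρ ![v₃₁, v₃₂, -c₃] ∈ latticeKer A := by
    have : ε₃ • relabel ρ ![v₃₁, v₃₂, -c₃] ∈ latticeKer A := hM.1 (by rw [hM']; simp)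
    rcases Int.units_eq_one_or ε₃ with rfl | rfl <;> simpa using this
  rw [mem_latticeKer_relabel] at mem1 mem2 mem3
  have hMr : M = Set.range fun s => (![ε₁, ε₂, ε₃] : Fin 3 → ℤˣ) s • relabel ρ
      ((![![-c₁, v₁₂, v₁₃], ![v₂₁, -c₂, v₂₃], ![v₃₁, v₃₂, -c₃]] : Fin 3 → Fin 3 → ℤ) s) := by
    rw [hM']
    ext z
    simp [Fin.exists_fin_succ, eq_comm]
  have P : ∀ s x y z, A 0 (ρ 0) * x + A 0 (ρ 1) * y + A 0 (ρ 2) * z = 0 →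
      0 < ![x, y, z] s → (∀ t, t ≠ s → ![x, y, z] t ≤ 0) →
      -(![![-c₁, v₁₂, v₁₃], ![v₂₁, -c₂, v₂₃], ![v₃₁, v₃₂, -c₃]] : Fin 3 → Fin 3 → ℤ) s s ≤
        ![x, y, z] s := by
    intro s x y z hz hs hneg
    have := hM.le_of_mem_latticeKer hMr (by intro s; fin_cases s <;> simp [*])
      (by intro s t hst; fin_cases s <;> fin_cases t <;> simp [*] at hst ⊢)
      (mem_latticeKer_relabel.2 hz) (s := s) (by rwa [relabel_apply])
      (fun t ht => by rw [relabel_apply]; exact hneg t ht)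
    rwa [relabel_apply] at this
  refine ⟨critical_eq_add (hpos (ρ 0)) (hpos (ρ 1)) (hpos (ρ 2)) h12 h13 h21 h23 h31 h32
    (by linarith) (by linarith) (by linarith) (fun x y z hz hx hy hz' => ?_)
    (fun x y z hz hx hy hz' => ?_) (fun x y z hz hx hy hz' => ?_), mem1⟩
  · simpa using P 0 x y z hz hx (by simp [Fin.forall_fin_succ, hy, hz'])
  · simpa using P 1 x y z hz hy (by simp [Fin.forall_fin_succ, hx, hz'])
  · simpa using P 2 x y z hz hz' (by simp [Fin.forall_fin_succ, hx, hy])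

lemma HasNonCIForm.isDistanceReducing {K : Type*} [Field K] {A : Matrix (Fin 1) (Fin 3) ℤ}
    (hpos : ∀ j, 0 < A 0 j) {M : Set (Fin 3 → ℤ)} (hM : IsMarkovBasis K A M)
    {ρ : Equiv.Perm (Fin 3)} (h01 : A 0 (ρ 0) < A 0 (ρ 1)) (h02 : A 0 (ρ 0) < A 0 (ρ 2))
    {c₁ c₂ c₃ v₁₂ v₁₃ v₂₁ v₂₃ v₃₁ v₃₂ : ℤ}
    (h : HasNonCIForm M ρ c₁ c₂ c₃ v₁₂ v₁₃ v₂₁ v₂₃ v₃₁ v₃₂)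
    (hv : v₂₁ < c₂ + v₂₃ ∨ v₃₁ < v₃₂ + c₃) : IsDistanceReducing A M := by
  obtain ⟨⟨e1, e2, e3⟩, mem1⟩ := h.relations hpos hM
  obtain ⟨-, -, -, h12, h13, h21, h23, h31, h32, ε₁, ε₂, ε₃, hM'⟩ := h
  have hc : v₁₂ + v₁₃ < c₁ := by
    have k1 : A 0 (ρ 0) * v₁₂ < A 0 (ρ 1) * v₁₂ := by gcongr
    have k2 : A 0 (ρ 0) * v₁₃ < A 0 (ρ 2) * v₁₃ := by gcongr
    refine lt_of_mul_lt_mul_left (a := A 0 (ρ 0)) ?_ (hpos _).le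
    linarith
  intro z hz hz0
  have hmem := hM.mem_span hz
  rw [hM', Submodule.mem_span_triple] at hmem
  obtain ⟨α, β, γ, rfl⟩ := hmem
  set α' := α * ε₁ with hα'
  set β' := β * ε₂ with hβ'
  set γ' := γ * ε₃ with hγ'
  have hform : α • ε₁ • relabel ρ ![-c₁, v₁₂, v₁₃] + β • ε₂ • relabel ρ ![v₂₁, -c₂, v₂₃] +
      γ • ε₃ • relabel ρ ![v₃₁, v₃₂, -c₃] = relabel ρ ![-(α' * c₁) + β' * v₂₁ + γ' * v₃₁,
        α' * v₁₂ - β' * c₂ + γ' * v₃₂, α' * v₁₃ + β' * v₂₃ - γ' * c₃] := by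
    rw [eq_relabel_iff]
    intro s
    simp only [units_zsmul_eq, Pi.add_apply, Pi.smul_apply, relabel_apply]
    fin_cases s <;> simp [hα', hβ', hγ'] <;> ring
  rw [hform] at hz0 ⊢
  have hne : ¬ (α' = β' ∧ β' = γ') := by
    rintro ⟨h4, h5⟩
    refine hz0 (Eq.symm ?_)
    rw [eq_relabel_iff, h4, h5, e1, e2, e3]
    intro s
    fin_cases s <;> simp <;> ring
  rw [hM']
  rcases nonCI_reduces h12 h13 h21 h23 h31 h32 e1 e2 e3 hc hv hne with h4 | h4 | h4
  · exact ⟨_, .inl rfl, by rwa [moveReduces_units_smul, moveReduces_relabel]⟩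
  · exact ⟨_, .inr (.inl rfl), by rwa [moveReduces_units_smul, moveReduces_relabel]⟩
  · exact ⟨_, .inr (.inr rfl), by rwa [moveReduces_units_smul, moveReduces_relabel]⟩

lemma IsDistanceReducing.circuits {A : Matrix (Fin 1) (Fin 3) ℤ} {M : Set (Fin 3 → ℤ)}
    (h : IsDistanceReducing A M) : ReducesDistance M (circuits A) :=
  fun z hz => h z hz.1

lemma reducesDistance_lastCircuit {A : Matrix (Fin 1) (Fin 3) ℤ} (hpos : ∀ j, 0 < A 0 j)
    {M : Set (Fin 3 → ℤ)} (h : ReducesDistance M (circuits A)) (ρ : Equiv.Perm (Fin 3)) :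
    ReducesDistance M {lastCircuit A ρ} := by
  obtain ⟨_, _, -, -, -, hc⟩ := lastCircuit_eq hpos ρ
  rintro z rfl
  exact h _ hc

lemma exists_sorting_perm {a : Fin 3 → ℤ} (ha : Function.Injective a) :
    ∃ ρ : Equiv.Perm (Fin 3), a (ρ 0) < a (ρ 1) ∧ a (ρ 1) < a (ρ 2) := by
  have hmono := (Tuple.monotone_sort a).strictMono_of_injective
    (ha.comp (Tuple.sort a).injective)
  exact ⟨Tuple.sort a, hmono (by decide), hmono (by decide)⟩

theorem mainTheorem4 (K : Type*) [Field K] (A : Matrix (Fin 1) (Fin 3) ℤ)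
    (hpos : ∀ j, 0 < A 0 j) (hdist : Function.Injective (A 0))
    (M : Set (Fin 3 → ℤ)) (hM : IsMinimalMarkovBasis K A M) :
    (IsDistanceReducing A M ↔ ReducesDistance M (circuits A)) ∧
    (IsCompleteIntersection K A →
      (∃ (ρ : Equiv.Perm (Fin 3)) (b₁ b₂ c₁ c₂ c₃ : ℤ), HasCIForm M ρ b₁ b₂ c₁ c₂ c₃) ∧
      ∀ (ρ : Equiv.Perm (Fin 3)) (b₁ b₂ c₁ c₂ c₃ : ℤ), HasCIForm M ρ b₁ b₂ c₁ c₂ c₃ →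
        List.TFAE [IsDistanceReducing A M, ReducesDistance M {lastCircuit A ρ}, c₁ < c₂ + c₃]) ∧
    (¬ IsCompleteIntersection K A →
      ∀ ρ : Equiv.Perm (Fin 3), A 0 (ρ 0) < A 0 (ρ 1) → A 0 (ρ 1) < A 0 (ρ 2) →
        (∃ c₁ c₂ c₃ v₁₂ v₁₃ v₂₁ v₂₃ v₃₁ v₃₂ : ℤ,
          HasNonCIForm M ρ c₁ c₂ c₃ v₁₂ v₁₃ v₂₁ v₂₃ v₃₁ v₃₂) ∧
        ∀ c₁ c₂ c₃ v₁₂ v₁₃ v₂₁ v₂₃ v₃₁ v₃₂ : ℤ,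
          HasNonCIForm M ρ c₁ c₂ c₃ v₁₂ v₁₃ v₂₁ v₂₃ v₃₁ v₃₂ →
            List.TFAE [IsDistanceReducing A M, ReducesDistance M {lastCircuit A ρ},
              v₂₁ < c₂ + v₂₃ ∨ v₃₁ < v₃₂ + c₃]) := by
  have hA := hM.form hpos hdist
  have hCI : ∀ (ρ : Equiv.Perm (Fin 3)) (b₁ b₂ c₁ c₂ c₃ : ℤ), HasCIForm M ρ b₁ b₂ c₁ c₂ c₃ →
      List.TFAE [IsDistanceReducing A M, ReducesDistance M {lastCircuit A ρ}, c₁ < c₂ + c₃] := by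
    intro ρ b₁ b₂ c₁ c₂ c₃ h
    tfae_have 1 → 2 := fun h1 => reducesDistance_lastCircuit hpos h1.circuits ρ
    tfae_have 2 → 3 := h.lt_of_reducesDistance hpos
    tfae_have 3 → 1 := h.isDistanceReducing hM.1
    tfae_finish
  have hN : ∀ ρ : Equiv.Perm (Fin 3), A 0 (ρ 0) < A 0 (ρ 1) → A 0 (ρ 1) < A 0 (ρ 2) →
      ∀ c₁ c₂ c₃ v₁₂ v₁₃ v₂₁ v₂₃ v₃₁ v₃₂ : ℤ,
        HasNonCIForm M ρ c₁ c₂ c₃ v₁₂ v₁₃ v₂₁ v₂₃ v₃₁ v₃₂ →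
          List.TFAE [IsDistanceReducing A M, ReducesDistance M {lastCircuit A ρ},
            v₂₁ < c₂ + v₂₃ ∨ v₃₁ < v₃₂ + c₃] := by
    intro ρ h01 h12 c₁ c₂ c₃ v₁₂ v₁₃ v₂₁ v₂₃ v₃₁ v₃₂ h
    tfae_have 1 → 2 := fun h1 => reducesDistance_lastCircuit hpos h1.circuits ρ
    tfae_have 2 → 3 := h.lt_of_reducesDistance hpos
    tfae_have 3 → 1 := h.isDistanceReducing hpos hM.1 h01 (h01.trans h12)
    tfae_finish
  refine ⟨⟨IsDistanceReducing.circuits, fun hc => ?_⟩, fun hci => ⟨?_, hCI⟩, fun hci ρ h01 h12 =>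
    ⟨?_, hN ρ h01 h12⟩⟩
  · rcases hA with ⟨ρ, b₁, b₂, c₁, c₂, c₃, h⟩ | h
    · exact ((hCI ρ _ _ _ _ _ h).out 1 0).1 (reducesDistance_lastCircuit hpos hc ρ)
    · obtain ⟨ρ, h01, h12⟩ := exists_sorting_perm hdist
      obtain ⟨c₁, c₂, c₃, v₁₂, v₁₃, v₂₁, v₂₃, v₃₁, v₃₂, hf⟩ := h ρ
      exact ((hN ρ h01 h12 _ _ _ _ _ _ _ _ _ hf).out 1 0).1
        (reducesDistance_lastCircuit hpos hc ρ)
  · refine hA.resolve_right fun h => ?_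
    obtain ⟨c₁, c₂, c₃, v₁₂, v₁₃, v₂₁, v₂₃, v₃₁, v₃₂, hf⟩ := h 1
    exact hf.not_isCompleteIntersection hpos hM.1 hci
  · refine hA.resolve_left (fun h => ?_) ρ
    obtain ⟨ρ, b₁, b₂, c₁, c₂, c₃, hf⟩ := h
    exact hci (hf.isCompleteIntersection hpos hM.1)
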